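/- Let $m \ge 1$ be an integer and let $p_0, \dots, p_m \in [0,1]$. Consider the following growth process of two-coloured graphs. Start from a finite graph $G_0$ (a multigraph, parallel edges and loops being allowed, a loop counting twice in the degree), each of whose nodes is coloured red or blue. Given $G_n$, the graph $G_{n+1}$ arises by adding one new node together with $m$ edges joining it to nodes of $G_n$; these $m$ endpoints are chosen independently, each being equal to a given node of $G_n$ with probability proportional to the degree of that node in $G_n$. If exactly $k$ of the $m$ edges lead to red nodes, then the new node becomes red with probability $p_k$ and blue with probability $1 - p_k$. Let $A_n$ and $B_n$ be the numbers of red and blue nodes of $G_n$, let $a_n = A_n / (A_n + B_n)$, and let $X_n$ and $Y_n$ be the sums of the degrees (in $G_n$) of the red and of the blue nodes, respectively. **Theorem (linear model).** Suppose that $p_k = k/m$ for all $0 \le k \le m$, and that $X_0 > 0$ and $Y_0 > 0$. Then $a_n$ converges almost surely. The law of the limit has support exactly $[0,1]$, has no atoms, and depends only on $X_0$, $Y_0$ and $m$ (and not otherwise on the initial coloured graph $G_0$). -/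

import Mathlib

open MeasureTheory Filter Topology

/-- A finite multigraph (parallel edges and loops allowed) on the nodes `0, …, order - 1`, each
node being red (`true`) or blue (`false`). -/
structure ColoredMultigraph where
  /-- number of nodes -/
  order : ℕ
  /-- colour of each node -/
  isRed : Fin order → Bool
  /-- the edges, with multiplicity -/
  edges : Multiset (Sym2 (Fin order))

namespace ColoredMultigraph

/-- Degree of a node: the number of edge ends at it (a loop has two ends). -/
def degree (g : ColoredMultigraph) (v : Fin g.order) : ℕ :=
  (g.edges.map fun e => e.toMultiset.count v).sum

/-- `A`: number of red nodes. -/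
def numRed (g : ColoredMultigraph) : ℕ :=
  (Finset.univ.filter fun v => g.isRed v = true).card

/-- `B`: number of blue nodes. -/
def numBlue (g : ColoredMultigraph) : ℕ :=
  (Finset.univ.filter fun v => g.isRed v = false).card

/-- `X`: sum of the degrees of the red nodes. -/
def redDegree (g : ColoredMultigraph) : ℕ :=
  ∑ v ∈ Finset.univ.filter (fun v => g.isRed v = true), g.degree v

/-- `Y`: sum of the degrees of the blue nodes. -/
def blueDegree (g : ColoredMultigraph) : ℕ :=
  ∑ v ∈ Finset.univ.filter (fun v => g.isRed v = false), g.degree v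

/-- `a = A / (A + B)`: fraction of red nodes. -/
noncomputable def redFraction (g : ColoredMultigraph) : ℝ :=
  (g.numRed : ℝ) / ((g.numRed : ℝ) + (g.numBlue : ℝ))

/-- Probability that a given new edge attaches to the existing node `v`: proportional to the
degree of `v` (linear preferential attachment). -/
noncomputable def attachProb (g : ColoredMultigraph) (v : Fin g.order) : ℝ :=
  (g.degree v : ℝ) / ∑ u, (g.degree u : ℝ)

/-- Number of the `m` chosen endpoints `t 0, …, t (m - 1)` that are red. -/
def numRedTargets (g : ColoredMultigraph) {m : ℕ} (t : Fin m → Fin g.order) : ℕ :=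
  (Finset.univ.filter fun i => g.isRed (t i) = true).card

/-- The graph obtained by adding one node of colour `c`, joined by `m` edges to the existing nodes
`t 0, …, t (m - 1)` (which may coincide). -/
def addNode (g : ColoredMultigraph) {m : ℕ} (t : Fin m → Fin g.order) (c : Bool) :
    ColoredMultigraph where
  order := g.order + 1
  isRed := Fin.snoc (α := fun _ => Bool) g.isRed c
  edges := g.edges.map (Sym2.map Fin.castSucc) +
    Finset.univ.val.map fun i : Fin m => s(Fin.last g.order, (t i).castSucc)

/-- Probability that the new node picks the endpoints `t 0, …, t (m - 1)` (independently of each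
other) and then receives the colour `c`: if `k` of the endpoints are red, then it becomes red with
probability `p k` and blue with probability `1 - p k`. -/
noncomputable def choiceProb (p : ℕ → ℝ) (g : ColoredMultigraph) {m : ℕ}
    (t : Fin m → Fin g.order) (c : Bool) : ℝ :=
  (∏ i, g.attachProb (t i)) *
    (if c = true then p (g.numRedTargets t) else 1 - p (g.numRedTargets t))

open Classical in
/-- One-step transition probability from `g` to `g'`: the total probability of the choices of
endpoints and colour of the new node that turn `g` into `g'`. -/
noncomputable def transProb (m : ℕ) (p : ℕ → ℝ) (g g' : ColoredMultigraph) : ℝ :=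
  ∑ t : Fin m → Fin g.order, ∑ c : Bool,
    if g.addNode t c = g' then choiceProb p g t c else 0

end ColoredMultigraph

/-- `G 0, G 1, G 2, …` is a two-colour preferential attachment process under the probability
measure `P`, started from `g₀`, with `m` edges per new node and colour adoption probabilities
`p 0, …, p m`. That is, it is a Markov chain on coloured multigraphs with the transition
probabilities `transProb m p`: given `G 0, …, G n`, the graph `G (n + 1)` arises from `G n` by
adding one node. -/
structure IsPrefAttachProcess (m : ℕ) (p : ℕ → ℝ) (g₀ : ColoredMultigraph)
    {Ω : Type*} [MeasurableSpace Ω] (P : Measure Ω) (G : ℕ → Ω → ColoredMultigraph) : Prop where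
  measurableSet_eq : ∀ n g, MeasurableSet {ω | G n ω = g}
  init : ∀ᵐ ω ∂P, G 0 ω = g₀
  step : ∀ (n : ℕ) (h : ℕ → ColoredMultigraph),
    P.real {ω | ∀ i ≤ n + 1, G i ω = h i} =
      P.real {ω | ∀ i ≤ n, G i ω = h i} *
        ColoredMultigraph.transProb m p (h n) (h (n + 1))

/-! In the linear model the quadruple (X, Y, A, B) is itself a Markov chain, an urn. A step adds 2m
edge ends. Given the red share x = X / (X + Y), the expected number of ends at red nodes among them
is 2mx: mx at old nodes, and m times the probability x that the new node is red. So x is a bounded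
martingale and converges to some L (`exists_limit_frac`). The excess X - 2mA has centred bounded
increments, hence is o(n), and the fraction of red nodes tends to L too (`tendsto_red_div_nodes`).
The pair (X, Y) evolves without regard to A and B, so the law of L depends only on X₀, Y₀ and m
(`map_limit_eq`).

Write D for the initial total degree and u = x(1 - x) at time 0. The conditional variance of a step
of x is of order x(1 - x) divided by the square of the current total degree, and these reciprocal
squares have a telescoping bound. This gives u/(4D) ≤ E(L - x₀)² ≤ (m + 3)/2 · u/D and E(L - x₀)⁴ ≤
K (u/D)² with K = `fourthMomentConst m`.

Support: with positive probability the urn is steered so that x is close to a given t while D is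
large; the variance bound and Chebyshev then keep L near t with positive probability
(`measure_limit_near_ne_zero`).

No atoms: the fourth moment is at most a constant, depending on m alone, times the square of the
second, whatever the starting state. A Paley-Zygmund argument gives P(L = r) ≤ 1 - δ with δ
depending on m only (`measureReal_limit_eq_le`). By the Markov property the bound holds
conditionally on every history. By Lévy's upward theorem these conditional probabilities converge to
the indicator of {L = r}, which therefore vanishes almost surely (`measure_limit_eq_zero`). -/

set_option linter.unusedSectionVars false

/-! ### Markov chains with finitely supported transitions: integrals and conditional expectations.
-/

section MarkovChain

variable {S : Type*} [MeasurableSpace S] {Ω : Type*} [mΩ : MeasurableSpace Ω]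

/-- A time-homogeneous Markov chain with finitely supported transition probabilities `T`, started
from `s₀`, described by the probabilities of its finite paths. -/
structure IsMarkovChain (T : S → S →₀ ℝ) (s₀ : S) (P : Measure Ω) (G : ℕ → Ω → S) : Prop where
  measurable : ∀ n, Measurable (G n)
  init : ∀ᵐ ω ∂P, G 0 ω = s₀
  step : ∀ (n : ℕ) (h : ℕ → S),
    P.real {ω | ∀ i ≤ n + 1, G i ω = h i} = P.real {ω | ∀ i ≤ n, G i ω = h i} * T (h n) (h (n + 1))

/-- The first `n + 1` values of a process. -/
def history (G : ℕ → Ω → S) (n : ℕ) (ω : Ω) : Finset.Iic n → S := fun i => G i ω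

/-- The last value of a finite path. -/
def lastValue {n : ℕ} (b : Finset.Iic n → S) : S := b ⟨n, Finset.mem_Iic.2 le_rfl⟩

@[simp] lemma lastValue_history (G : ℕ → Ω → S) (n : ℕ) (ω : Ω) :
    lastValue (history G n ω) = G n ω := rfl

lemma measurable_history {G : ℕ → Ω → S} (hG : ∀ n, Measurable (G n)) (n : ℕ) :
    Measurable (history G n) :=
  measurable_pi_lambda _ fun i => hG i

/-- The filtration generated by a process. -/
def historyFiltration {G : ℕ → Ω → S} (hG : ∀ n, Measurable (G n)) :
    Filtration ℕ mΩ where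
  seq n := MeasurableSpace.comap (history G n) inferInstance
  mono' n k hnk := by
    have h : history G n = (fun b (i : Finset.Iic n) =>
        b ⟨i, Finset.mem_Iic.2 ((Finset.mem_Iic.1 i.2).trans hnk)⟩) ∘ history G k := rfl
    change MeasurableSpace.comap (history G n) _ ≤ MeasurableSpace.comap (history G k) _
    rw [h, ← MeasurableSpace.comap_comp]
    exact MeasurableSpace.comap_mono
      (measurable_pi_lambda _ fun i => measurable_pi_apply _).comap_le
  le' n := (measurable_history hG n).comap_le

lemma integrable_of_ae_mem_finset {E : Type*} [MeasurableSpace E] [Countable E]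
    [MeasurableSingletonClass E] {P : Measure Ω} [IsFiniteMeasure P] {Z : Ω → E}
    (hZ : Measurable Z) {K : Finset E} (hK : ∀ᵐ ω ∂P, Z ω ∈ K) (f : E → ℝ) :
    Integrable (fun ω => f (Z ω)) P := by
  refine Integrable.of_bound ((measurable_of_countable f).comp hZ).aestronglyMeasurable
    (∑ b ∈ K, |f b|) ?_
  filter_upwards [hK] with ω hω
  exact Finset.single_le_sum (f := fun b => |f b|) (fun _ _ => abs_nonneg _) hω

lemma integral_eq_sum_of_ae_mem_finset {E : Type*} [MeasurableSpace E]
    [MeasurableSingletonClass E] {P : Measure Ω} [IsFiniteMeasure P] {Z : Ω → E}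
    (hZ : Measurable Z) {K : Finset E} (hK : ∀ᵐ ω ∂P, Z ω ∈ K) (f : E → ℝ) :
    ∫ ω, f (Z ω) ∂P = ∑ b ∈ K, P.real (Z ⁻¹' {b}) * f b := by
  classical
  have h : (fun ω => f (Z ω)) =ᵐ[P]
      fun ω => ∑ b ∈ K, (Z ⁻¹' {b}).indicator (fun _ => f b) ω := by
    filter_upwards [hK] with ω hω
    rw [Finset.sum_eq_single_of_mem _ hω]
    · simp
    · intro b _ hb
      exact Set.indicator_of_notMem (fun h => hb (by simpa using h.symm)) _
  rw [integral_congr_ae h, integral_finsetSum]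
  · refine Finset.sum_congr rfl fun b _ => ?_
    rw [integral_indicator_const _ (hZ (measurableSet_singleton b))]
    rfl
  · intro b _
    exact (integrable_const _).indicator (hZ (measurableSet_singleton b))

namespace IsMarkovChain

variable {T : S → S →₀ ℝ} {s₀ : S} {P : Measure Ω} {G : ℕ → Ω → S}

/-- Restates `step`, which is phrased with infinite reference paths, for a finite history and a next
state; the reference path is `b` continued by the constant `s`. -/
lemma measureReal_history_inter (h : IsMarkovChain T s₀ P G) (n : ℕ) (b : Finset.Iic n → S)
    (s : S) :
    P.real (history G n ⁻¹' {b} ∩ G (n + 1) ⁻¹' {s}) =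
      P.real (history G n ⁻¹' {b}) * T (lastValue b) s := by
  classical
  let p : ℕ → S := fun i => if hi : i ≤ n then b ⟨i, Finset.mem_Iic.2 hi⟩ else s
  have h1 : history G n ⁻¹' {b} = {ω | ∀ i ≤ n, G i ω = p i} := by
    ext ω
    simp only [Set.mem_preimage, Set.mem_singleton_iff, Set.mem_ofPred_eq, funext_iff, history]
    constructor
    · intro hω i hi
      simp only [p, hi, dite_true]
      exact hω ⟨i, _⟩
    · rintro hω ⟨i, hi⟩
      have hi' := Finset.mem_Iic.1 hi
      have := hω i hi'
      simpa only [p, hi', dite_true] using this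
  have h2 : history G n ⁻¹' {b} ∩ G (n + 1) ⁻¹' {s} = {ω | ∀ i ≤ n + 1, G i ω = p i} := by
    rw [h1]
    ext ω
    have hp : p (n + 1) = s := by simp [p]
    simp only [Set.mem_inter_iff, Set.mem_ofPred_eq, Set.mem_preimage, Set.mem_singleton_iff]
    constructor
    · rintro ⟨ha, hb⟩ i hi
      rcases Nat.le_succ_iff.1 hi with hi | rfl
      · exact ha i hi
      · rw [hp]; exact hb
    · intro ha
      exact ⟨fun i hi => ha i (by lia), by rw [ha _ le_rfl, hp]⟩
  have h3 : p n = lastValue b := by simp [p, lastValue]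
  have h4 : p (n + 1) = s := by simp [p]
  rw [h2, h1, h.step, h3, h4]

variable [Countable S] [MeasurableSingletonClass S] [IsFiniteMeasure P]

lemma ae_mem_support (h : IsMarkovChain T s₀ P G) :
    ∀ᵐ ω ∂P, ∀ n, T (G n ω) (G (n + 1) ω) ≠ 0 := by
  rw [ae_all_iff]
  intro n
  have : ∀ᵐ ω ∂P, ∀ (b : Finset.Iic n → S) (s : S), T (lastValue b) s = 0 →
      ¬ (history G n ω = b ∧ G (n + 1) ω = s) := by
    rw [ae_all_iff]
    intro b
    rw [ae_all_iff]
    intro s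
    by_cases hT : T (lastValue b) s = 0
    · have := h.measureReal_history_inter n b s
      rw [hT, mul_zero, measureReal_eq_zero_iff] at this
      filter_upwards [measure_eq_zero_iff_ae_notMem.1 this] with ω hω _ hc
      exact hω hc
    · exact ae_of_all _ fun _ hc => absurd hc hT
  filter_upwards [this] with ω hω h0
  exact hω (history G n ω) (G (n + 1) ω) h0 ⟨rfl, rfl⟩

/-- Since each `T s` has finite support, only finitely many states are reachable by a given time.
Every function of a history is therefore integrable and its integral is a finite sum, with no growth
condition. -/
lemma exists_finset_ae_mem (h : IsMarkovChain T s₀ P G) :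
    ∃ K : ℕ → Finset S, ∀ n, (∀ᵐ ω ∂P, G n ω ∈ K n) ∧ ∀ s ∈ K n, (T s).support ⊆ K (n + 1) := by
  classical
  refine ⟨fun n => Nat.rec {s₀} (fun _ K => K.biUnion fun s => (T s).support) n, fun n => ?_⟩
  have hsub : ∀ n : ℕ, ∀ s ∈ (Nat.rec {s₀} (fun _ K => K.biUnion fun s => (T s).support) n :
      Finset S), (T s).support ⊆ (Nat.rec {s₀} (fun _ K => K.biUnion fun s => (T s).support)
        (n + 1) : Finset S) :=
    fun n s hs => Finset.subset_biUnion_of_mem (fun s => (T s).support) hs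
  refine ⟨?_, hsub n⟩
  induction n with
  | zero => filter_upwards [h.init] with ω hω; simp [hω]
  | succ n ih =>
    filter_upwards [ih, h.ae_mem_support] with ω hω hs
    exact hsub n _ hω (Finsupp.mem_support_iff.2 (hs n))

lemma exists_finset_ae_history_mem (h : IsMarkovChain T s₀ P G) (n : ℕ) :
    ∃ (K : Finset (Finset.Iic n → S)) (K' : Finset S), (∀ᵐ ω ∂P, history G n ω ∈ K) ∧
      (∀ᵐ ω ∂P, G (n + 1) ω ∈ K') ∧ ∀ b ∈ K, (T (lastValue b)).support ⊆ K' := by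
  classical
  obtain ⟨K, hK⟩ := h.exists_finset_ae_mem
  refine ⟨Fintype.piFinset fun i => K i, K (n + 1), ?_, (hK (n + 1)).1, fun b hb => ?_⟩
  · have : ∀ᵐ ω ∂P, ∀ i, G i ω ∈ K i := ae_all_iff.2 fun i => (hK i).1
    filter_upwards [this] with ω hω
    exact Fintype.mem_piFinset.2 fun i => hω i
  · exact (hK n).2 _ (Fintype.mem_piFinset.1 hb _)

lemma integrable_history (h : IsMarkovChain T s₀ P G) (n : ℕ) (f : (Finset.Iic n → S) → ℝ) :
    Integrable (fun ω => f (history G n ω)) P := by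
  obtain ⟨K, _, hK, _⟩ := h.exists_finset_ae_history_mem n
  exact integrable_of_ae_mem_finset (measurable_history h.measurable n) hK f

lemma integrable (h : IsMarkovChain T s₀ P G) (n : ℕ) (f : S → ℝ) :
    Integrable (fun ω => f (G n ω)) P :=
  h.integrable_history n fun b => f (lastValue b)

/-- Integrating a function of the past and the next value amounts to averaging it first over the
transition probabilities. -/
lemma integral_history_succ (h : IsMarkovChain T s₀ P G) (n : ℕ)
    (Ψ : (Finset.Iic n → S) → S → ℝ) :
    ∫ ω, Ψ (history G n ω) (G (n + 1) ω) ∂P =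
      ∫ ω, Finsupp.linearCombination ℝ (Ψ (history G n ω)) (T (G n ω)) ∂P := by
  obtain ⟨K, K', hK, hK', hsub⟩ := h.exists_finset_ae_history_mem n
  have hm := measurable_history h.measurable n
  have h1 := integral_eq_sum_of_ae_mem_finset (P := P) (hm.prodMk (h.measurable (n + 1)))
    (K := K ×ˢ K') (by filter_upwards [hK, hK'] with ω h1 h2 using Finset.mk_mem_product h1 h2)
    (fun z => Ψ z.1 z.2)
  have h2 := integral_eq_sum_of_ae_mem_finset (P := P) hm hK
    (fun b => Finsupp.linearCombination ℝ (Ψ b) (T (lastValue b)))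
  simp only [lastValue_history] at h2
  rw [h1, h2, Finset.sum_product]
  refine Finset.sum_congr rfl fun b hb => ?_
  rw [Finsupp.linearCombination_apply, Finsupp.sum_of_support_subset _ (hsub b hb) _ (by simp),
    Finset.mul_sum]
  refine Finset.sum_congr rfl fun s _ => ?_
  rw [← Set.singleton_prod_singleton, Set.mk_preimage_prod, h.measureReal_history_inter,
    smul_eq_mul]
  ring

lemma integral_succ (h : IsMarkovChain T s₀ P G) (n : ℕ) (f : S → ℝ) :
    ∫ ω, f (G (n + 1) ω) ∂P = ∫ ω, Finsupp.linearCombination ℝ f (T (G n ω)) ∂P :=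
  h.integral_history_succ n fun _ => f

/-- Tested against an event of the past with history in `B`, this is `integral_history_succ` for the
indicator of `B` times `f`. -/
lemma condExp_succ (h : IsMarkovChain T s₀ P G) (n : ℕ) (f : S → ℝ) :
    P[fun ω => f (G (n + 1) ω) | historyFiltration h.measurable n] =ᵐ[P]
      fun ω => Finsupp.linearCombination ℝ f (T (G n ω)) := by
  have hm := measurable_history h.measurable n
  refine (ae_eq_condExp_of_forall_setIntegral_eq ((historyFiltration h.measurable).le n)
    (h.integrable (n + 1) f)
    (fun s _ _ => (h.integrable n fun s => Finsupp.linearCombination ℝ f (T s)).integrableOn)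
    ?_ ?_).symm
  · rintro s ⟨B, hB, rfl⟩ -
    rw [← integral_indicator (hm hB), ← integral_indicator (hm hB)]
    have := h.integral_history_succ n fun b s => B.indicator (fun _ => f s) b
    refine Eq.trans ?_ (this.symm.trans ?_)
    · refine integral_congr_ae (ae_of_all _ fun ω => ?_)
      by_cases hω : history G n ω ∈ B
      · simp [hω]
      · simp only [Set.indicator_of_notMem hω, Set.indicator_of_notMem (s := history G n ⁻¹' B) hω]
        simp [Finsupp.linearCombination_apply]
    · rfl
  · refine StronglyMeasurable.aestronglyMeasurable ?_
    exact ((measurable_of_countable fun b : Finset.Iic n → S =>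
      Finsupp.linearCombination ℝ f (T (lastValue b))).comp
        (comap_measurable (history G n))).stronglyMeasurable

lemma stronglyAdapted (h : IsMarkovChain T s₀ P G) (f : ℕ → S → ℝ) :
    StronglyAdapted (historyFiltration h.measurable) fun n ω => f n (G n ω) := fun n =>
  ((measurable_of_countable fun b : Finset.Iic n → S => f n (lastValue b)).comp
    (comap_measurable (history G n))).stronglyMeasurable

lemma martingale (h : IsMarkovChain T s₀ P G) (f : S → ℝ)
    (hf : ∀ n, ∀ᵐ ω ∂P, Finsupp.linearCombination ℝ f (T (G n ω)) = f (G n ω)) :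
    Martingale (fun n ω => f (G n ω)) (historyFiltration h.measurable) P := by
  refine martingale_nat (h.stronglyAdapted fun _ => f) (fun n => h.integrable n f) fun n => ?_
  filter_upwards [hf n, h.condExp_succ n f] with ω h1 h2
  rw [h2, h1]

lemma supermartingale (h : IsMarkovChain T s₀ P G) (f : S → ℝ)
    (hf : ∀ n, ∀ᵐ ω ∂P, Finsupp.linearCombination ℝ f (T (G n ω)) ≤ f (G n ω)) :
    Supermartingale (fun n ω => f (G n ω)) (historyFiltration h.measurable) P := by
  refine supermartingale_nat (h.stronglyAdapted fun _ => f) (fun n => h.integrable n f) fun n => ?_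
  filter_upwards [hf n, h.condExp_succ n f] with ω h1 h2
  rw [h2]; exact h1

end IsMarkovChain

end MarkovChain

/-! ### Markov property, functions of a chain, and existence of chains. -/

section MarkovChainConstructions

open ProbabilityTheory

variable {S : Type*} [MeasurableSpace S] [Countable S] [MeasurableSingletonClass S]
  {Ω : Type*} [mΩ : MeasurableSpace Ω] {T : S → S →₀ ℝ} {s₀ : S} {P : Measure Ω}
  {G : ℕ → Ω → S}

namespace IsMarkovChain

lemma measurableSet_path (h : IsMarkovChain T s₀ P G) (n : ℕ) (g : ℕ → S) :
    MeasurableSet {ω | ∀ i ≤ n, G i ω = g i} := by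
  have : {ω | ∀ i ≤ n, G i ω = g i} = ⋂ i, ⋂ (_ : i ≤ n), G i ⁻¹' {g i} := by ext; simp
  rw [this]
  exact MeasurableSet.iInter fun i => MeasurableSet.iInter fun _ =>
    h.measurable i (measurableSet_singleton _)

/-- Markov property: conditioned on a path up to time `n`, the future is a Markov chain started
from the end of that path. -/
lemma cond_path (h : IsMarkovChain T s₀ P G) (n : ℕ) (g : ℕ → S) :
    IsMarkovChain T (g n) (P[|{ω | ∀ i ≤ n, G i ω = g i}]) (fun k => G (n + k)) where
  measurable k := h.measurable _
  init := by
    have := ae_cond_mem (μ := P) (h.measurableSet_path n g)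
    filter_upwards [this] with ω hω using hω n le_rfl
  step k p := by
    classical
    have hA := h.measurableSet_path n g
    -- The two paths overlap at time `n`: they glue to one path if they agree there, and the
    -- intersection is empty otherwise.
    have key : ∀ j, {ω | ∀ i ≤ n, G i ω = g i} ∩ {ω | ∀ i ≤ j, G (n + i) ω = p i} =
        if g n = p 0 then {ω | ∀ i ≤ n + j, G i ω = if i ≤ n then g i else p (i - n)} else ∅ := by
      intro j
      ext ω
      split_ifs with h0
      · simp only [Set.mem_inter_iff, Set.mem_ofPred_eq]
        constructor
        · rintro ⟨h1, h2⟩ i hi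
          split_ifs with hin
          · exact h1 i hin
          · have := h2 (i - n) (by lia)
            rwa [Nat.add_sub_cancel' (by lia)] at this
        · intro h1
          refine ⟨fun i hi => by simpa [hi] using h1 i (by lia), fun i hi => ?_⟩
          have := h1 (n + i) (by lia)
          rcases Nat.eq_zero_or_pos i with rfl | hpos
          · simpa [h0] using this
          · rwa [if_neg (by lia), Nat.add_sub_cancel_left] at this
      · simp only [Set.mem_inter_iff, Set.mem_ofPred_eq, Set.mem_empty_iff_false, iff_false]
        rintro ⟨h1, h2⟩
        exact h0 ((h1 n le_rfl).symm.trans (h2 0 (Nat.zero_le _)))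
    rw [measureReal_def, measureReal_def, cond_apply hA, cond_apply hA, key, key]
    split_ifs with h0
    · have := h.step (n + k) fun i => if i ≤ n then g i else p (i - n)
      have h1 : (if n + k ≤ n then g (n + k) else p (n + k - n)) = p k := by
        rcases Nat.eq_zero_or_pos k with rfl | hpos
        · simpa using h0
        · rw [if_neg (by lia), Nat.add_sub_cancel_left]
      have h2 : (if n + k + 1 ≤ n then g (n + k + 1) else p (n + k + 1 - n)) = p (k + 1) := by
        rw [if_neg (by lia)]
        congr 1
        lia
      rw [h1, h2] at this
      simp only [measureReal_def] at this
      rw [ENNReal.toReal_mul, ENNReal.toReal_mul, ← add_assoc, this, mul_assoc]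
    · simp

/-- A function of a Markov chain is a Markov chain if the transition probabilities between its
values depend on the current value only. -/
lemma comp {S' : Type*} [MeasurableSpace S'] [IsFiniteMeasure P] {T' : S' → S' →₀ ℝ}
    (h : IsMarkovChain T s₀ P G) (φ : S → S')
    (hT : ∀ n, ∀ᵐ ω ∂P, (T (G n ω)).mapDomain φ = T' (φ (G n ω))) :
    IsMarkovChain T' (φ s₀) P (fun n ω => φ (G n ω)) where
  measurable n := (measurable_of_countable φ).comp (h.measurable n)
  init := by filter_upwards [h.init] with ω hω; rw [hω]
  step n p := by
    classical
    have hmeas : ∀ n, MeasurableSet {ω | ∀ i ≤ n, φ (G i ω) = p i} := by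
      intro n
      have : {ω | ∀ i ≤ n, φ (G i ω) = p i} = ⋂ i, ⋂ (_ : i ≤ n), G i ⁻¹' (φ ⁻¹' {p i}) := by
        ext; simp
      rw [this]
      exact MeasurableSet.iInter fun i => MeasurableSet.iInter fun _ =>
        h.measurable i (Set.to_countable _).measurableSet
    -- Averaging the second factor over `T` gives the mass of `p (n + 1)` under the image of `T`,
    -- which `hT` identifies with `T'`.
    let Ψ : (Finset.Iic n → S) → S → ℝ := fun b s =>
      (if ∀ i, φ (b i) = p i then 1 else 0) * (if φ s = p (n + 1) then 1 else 0)
    have hi : ∀ ω, (∀ i : Finset.Iic n, φ (history G n ω i) = p i) ↔ ∀ i ≤ n, φ (G i ω) = p i :=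
      fun ω => ⟨fun h i hi => h ⟨i, Finset.mem_Iic.2 hi⟩, fun h i => h i (Finset.mem_Iic.1 i.2)⟩
    have h1 := h.integral_history_succ n Ψ
    rw [← integral_indicator_one (hmeas (n + 1)), ← integral_indicator_one (hmeas n),
      ← integral_mul_const]
    refine Eq.trans ?_ (h1.trans ?_)
    · refine integral_congr_ae (ae_of_all _ fun ω => ?_)
      have : (∀ i ≤ n + 1, φ (G i ω) = p i) ↔
          (∀ i ≤ n, φ (G i ω) = p i) ∧ φ (G (n + 1) ω) = p (n + 1) :=
        ⟨fun h => ⟨fun i hi => h i (by lia), h _ le_rfl⟩, fun h i hi => by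
          rcases Nat.le_succ_iff.1 hi with hi | rfl
          exacts [h.1 i hi, h.2]⟩
      simp only [Ψ, hi, Set.indicator_apply, Set.mem_ofPred_eq, this, Pi.one_apply]
      split_ifs <;> simp_all
    · refine integral_congr_ae ?_
      filter_upwards [hT n] with ω hω
      simp only [Ψ, hi, Set.indicator_apply, Set.mem_ofPred_eq, Pi.one_apply]
      split_ifs with hp
      · have := DFunLike.congr_fun hω (p (n + 1))
        rw [hp n le_rfl] at this
        rw [← this, Finsupp.mapDomain, Finsupp.sum_apply, Finsupp.linearCombination_apply]
        simp [Finsupp.single_apply]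
      · simp [Finsupp.linearCombination_apply]

end IsMarkovChain

/-- The Ionescu-Tulcea measure with its prefix laws. -/
lemma exists_measure_map_frestrictLe {X : ℕ → Type*} [∀ n, MeasurableSpace (X n)]
    (κ : (n : ℕ) → Kernel ((i : Finset.Iic n) → X i) (X (n + 1))) [∀ n, IsMarkovKernel (κ n)]
    (x₀ : (i : Finset.Iic 0) → X i) :
    ∃ P : Measure ((n : ℕ) → X n), IsProbabilityMeasure P ∧
      (∀ n, P.map (Preorder.frestrictLe n) = Kernel.partialTraj κ 0 n x₀) ∧
      ∀ n, (Kernel.partialTraj κ 0 n x₀) ⊗ₘ κ n =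
        P.map (fun x => (Preorder.frestrictLe n x, x (n + 1))) :=
  ⟨Kernel.traj κ 0 x₀, inferInstance, fun n => Kernel.traj_map_frestrictLe_apply 0 n x₀,
    fun n => Kernel.partialTraj_compProd_eq_map_traj (Nat.zero_le n)⟩

/-- A Markov chain with given transition probabilities exists. -/
theorem exists_isMarkovChain (T : S → S →₀ ℝ) (hT : ∀ s s', 0 ≤ T s s')
    (hT1 : ∀ s, ((T s).sum fun _ x => x) = 1) (s₀ : S) :
    ∃ (P : Measure (ℕ → S)) (G : ℕ → (ℕ → S) → S), IsProbabilityMeasure P ∧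
      IsMarkovChain T s₀ P G := by
  classical
  let μ : S → Measure S := fun s => ∑ s' ∈ (T s).support, ENNReal.ofReal (T s s') • Measure.dirac s'
  have hμ1 : ∀ s, IsProbabilityMeasure (μ s) := fun s => ⟨by
    simp only [μ, Measure.coe_finsetSum, Finset.sum_apply, Measure.smul_apply, measure_univ,
      smul_eq_mul, mul_one]
    rw [← ENNReal.ofReal_sum_of_nonneg fun s' _ => hT s s']
    exact (congrArg ENNReal.ofReal (hT1 s)).trans ENNReal.ofReal_one⟩
  have hμ : ∀ s s', μ s {s'} = ENNReal.ofReal (T s s') := by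
    intro s s'
    simp only [μ, Measure.coe_finsetSum, Finset.sum_apply, Measure.smul_apply, smul_eq_mul,
      Measure.dirac_apply' _ (measurableSet_singleton s'), Set.indicator_apply,
      Set.mem_singleton_iff, Pi.one_apply, mul_ite, mul_one, mul_zero, Finset.sum_ite_eq',
      Finsupp.mem_support_iff]
    split_ifs with h0
    · rfl
    · simp [not_not.1 h0]
  let κ : (n : ℕ) → Kernel ((i : Finset.Iic n) → (fun _ : ℕ => S) i) S := fun n =>
    ⟨fun b => μ (lastValue b), measurable_of_countable _⟩
  have hκ : ∀ n, IsMarkovKernel (κ n) := fun n => ⟨fun b => hμ1 _⟩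
  let x₀ : (i : Finset.Iic 0) → (fun _ : ℕ => S) i := fun _ => s₀
  obtain ⟨P, hP, hmap, hprod⟩ := exists_measure_map_frestrictLe (X := fun _ => S) κ x₀
  refine ⟨P, fun n ω => ω n, hP, fun n => measurable_pi_apply n, ?_, ?_⟩
  · have h0 : P.map (Preorder.frestrictLe (π := fun _ => S) 0) = Measure.dirac x₀ := by
      rw [hmap, Kernel.partialTraj_self, Kernel.id_apply]
    have h1 : ∀ᵐ b ∂(P.map (Preorder.frestrictLe (π := fun _ => S) 0)), b = x₀ := by
      rw [h0]
      exact (ae_dirac_iff (p := fun b => b = x₀) (measurableSet_singleton x₀)).2 rfl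
    filter_upwards [ae_of_ae_map (Preorder.measurable_frestrictLe 0).aemeasurable h1] with ω hω
    exact congrFun hω ⟨0, by simp⟩
  · intro n p
    let b : (i : Finset.Iic n) → (fun _ : ℕ => S) i := fun i => p i
    have hm : Measurable fun x : ℕ → S => (Preorder.frestrictLe (π := fun _ => S) n x, x (n + 1)) :=
      (Preorder.measurable_frestrictLe n).prodMk (measurable_pi_apply _)
    have e1 : {ω : ℕ → S | ∀ i ≤ n, ω i = p i} =
        Preorder.frestrictLe (π := fun _ => S) n ⁻¹' {b} := by
      ext ω
      simp only [Set.mem_ofPred_eq, Set.mem_preimage, Set.mem_singleton_iff, funext_iff, b]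
      exact ⟨fun h i => h i (Finset.mem_Iic.1 i.2), fun h i hi => h ⟨i, Finset.mem_Iic.2 hi⟩⟩
    have e2 : {ω : ℕ → S | ∀ i ≤ n + 1, ω i = p i} =
        (fun x : ℕ → S => (Preorder.frestrictLe (π := fun _ => S) n x, x (n + 1))) ⁻¹'
          ({b} ×ˢ {p (n + 1)}) := by
      rw [Set.mk_preimage_prod, ← e1]
      ext ω
      simp only [Set.mem_ofPred_eq, Set.mem_inter_iff, Set.mem_preimage, Set.mem_singleton_iff]
      refine ⟨fun h => ⟨fun i hi => h i (by lia), h _ le_rfl⟩, fun h i hi => ?_⟩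
      rcases Nat.le_succ_iff.1 hi with hi | rfl
      exacts [h.1 i hi, h.2]
    have e3 : P {ω : ℕ → S | ∀ i ≤ n + 1, ω i = p i} =
        P {ω : ℕ → S | ∀ i ≤ n, ω i = p i} * ENNReal.ofReal (T (p n) (p (n + 1))) := by
      rw [e2, ← Measure.map_apply hm ((measurableSet_singleton b).prod (measurableSet_singleton _)),
        ← hprod, Measure.compProd_apply_prod (measurableSet_singleton b) (measurableSet_singleton _),
        lintegral_singleton, e1, ← Measure.map_apply (Preorder.measurable_frestrictLe n)
          (measurableSet_singleton b), hmap, mul_comm]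
      exact congrArg _ (hμ _ _)
    rw [measureReal_def, e3, ENNReal.toReal_mul, ENNReal.toReal_ofReal (hT _ _)]
    rfl

end MarkovChainConstructions

/-! ### One step of the urn: conditional moments of the red share. -/

section UrnStep

/-- Expectation of `φ k c`, where `k` is a binomial variable with parameters `m` and `x` and, given
`k`, the colour `c` is red with probability `k / m`. -/
noncomputable def urnMean (m : ℕ) (x : ℝ) (φ : ℕ → Bool → ℝ) : ℝ :=
  ∑ k ∈ Finset.range (m + 1), (m.choose k * x ^ k * (1 - x) ^ (m - k)) *
    ((k / m : ℝ) * φ k true + (1 - k / m : ℝ) * φ k false)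

lemma sum_binomial_weight (m : ℕ) (x : ℝ) :
    ∑ k ∈ Finset.range (m + 1), (m.choose k * x ^ k * (1 - x) ^ (m - k) : ℝ) = 1 := by
  have := congrArg (Polynomial.eval x) (bernsteinPolynomial.sum ℝ m)
  simpa [bernsteinPolynomial, Polynomial.eval_finsetSum] using this

lemma sum_binomial_weight_mul (m : ℕ) (x : ℝ) :
    ∑ k ∈ Finset.range (m + 1), (m.choose k * x ^ k * (1 - x) ^ (m - k) : ℝ) * k = m * x := by
  have := congrArg (Polynomial.eval x) (bernsteinPolynomial.sum_smul ℝ m)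
  simp only [bernsteinPolynomial, Polynomial.eval_finsetSum] at this
  simpa [mul_comm] using this

lemma sum_binomial_weight_mul_sq (m : ℕ) (x : ℝ) :
    ∑ k ∈ Finset.range (m + 1), (m.choose k * x ^ k * (1 - x) ^ (m - k) : ℝ) * (k : ℝ) ^ 2 =
      m * x + m * (m - 1) * x ^ 2 := by
  have h := congrArg (Polynomial.eval x) (bernsteinPolynomial.sum_mul_smul ℝ m)
  simp only [bernsteinPolynomial, Polynomial.eval_finsetSum] at h
  have hc : ∀ k : ℕ, ((k * (k - 1) : ℕ) : ℝ) = (k : ℝ) * (k - 1) := by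
    rintro (_ | k) <;> simp
  simp only [nsmul_eq_mul, Polynomial.eval_mul, Polynomial.eval_natCast, Polynomial.eval_pow,
    Polynomial.eval_X, Polynomial.eval_sub, Polynomial.eval_one, hc] at h
  rw [← sum_binomial_weight_mul m x, ← h, ← Finset.sum_add_distrib]
  exact Finset.sum_congr rfl fun k _ => by ring

lemma urnMean_const (m : ℕ) (x a : ℝ) : urnMean m x (fun _ _ => a) = a := by
  have : ∀ k : ℕ, ((k / m : ℝ) * a + (1 - k / m : ℝ) * a) = a := fun k => by ring
  simp only [urnMean, this]
  rw [← Finset.sum_mul, sum_binomial_weight, one_mul]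

lemma urnMean_add (m : ℕ) (x : ℝ) (φ ψ : ℕ → Bool → ℝ) :
    urnMean m x (fun k c => φ k c + ψ k c) = urnMean m x φ + urnMean m x ψ := by
  simp only [urnMean, ← Finset.sum_add_distrib]
  exact Finset.sum_congr rfl fun k _ => by ring

lemma urnMean_const_mul (m : ℕ) (x a : ℝ) (φ : ℕ → Bool → ℝ) :
    urnMean m x (fun k c => a * φ k c) = a * urnMean m x φ := by
  simp only [urnMean, Finset.mul_sum]
  exact Finset.sum_congr rfl fun k _ => by ring

lemma urnMean_mono {m : ℕ} {x : ℝ} (h0 : 0 ≤ x) (h1 : x ≤ 1) {φ ψ : ℕ → Bool → ℝ}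
    (h : ∀ k ≤ m, ∀ c, φ k c ≤ ψ k c) : urnMean m x φ ≤ urnMean m x ψ := by
  refine Finset.sum_le_sum fun k hk => ?_
  have hk : k ≤ m := by simpa [Nat.lt_succ_iff] using hk
  have hkm : (k / m : ℝ) ≤ 1 := div_le_one_of_le₀ (by exact_mod_cast hk) (by positivity)
  have : 0 ≤ 1 - x := sub_nonneg.2 h1
  have := sub_nonneg.2 hkm
  gcongr
  exacts [h k hk _, h k hk _]

lemma urnMean_congr {m : ℕ} (x : ℝ) {φ ψ : ℕ → Bool → ℝ}
    (h : ∀ k ≤ m, ∀ c, φ k c = ψ k c) : urnMean m x φ = urnMean m x ψ := by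
  refine Finset.sum_congr rfl fun k hk => ?_
  have hk : k ≤ m := by simpa [Nat.lt_succ_iff] using hk
  rw [h k hk, h k hk]

/-- Increase of the total degree of the red nodes if `k` of the new edges lead to red nodes and
the new node has colour `c`. -/
def redGain (m k : ℕ) (c : Bool) : ℕ := k + if c then m else 0

lemma urnMean_redGain {m : ℕ} (hm : m ≠ 0) (x : ℝ) :
    urnMean m x (fun k c => (redGain m k c : ℝ)) = 2 * m * x := by
  have hm' : (m : ℝ) ≠ 0 := by exact_mod_cast hm
  have : ∀ k : ℕ, (k / m : ℝ) * (redGain m k true : ℕ) + (1 - k / m : ℝ) * (redGain m k false : ℕ)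
      = 2 * k := fun k => by
    simp only [redGain]; push_cast; simp; field_simp; ring
  simp only [urnMean, this]
  have h := sum_binomial_weight_mul m x
  calc _ = 2 * ∑ k ∈ Finset.range (m + 1),
        (m.choose k * x ^ k * (1 - x) ^ (m - k) : ℝ) * k := by
        rw [Finset.mul_sum]; exact Finset.sum_congr rfl fun k _ => by ring
    _ = _ := by rw [h]; ring

lemma urnMean_redGain_sq {m : ℕ} (hm : m ≠ 0) (x : ℝ) :
    urnMean m x (fun k c => (redGain m k c : ℝ) ^ 2) =
      (m ^ 2 + 3 * m) * (x * (1 - x)) + (2 * m * x) ^ 2 := by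
  have hm' : (m : ℝ) ≠ 0 := by exact_mod_cast hm
  have : ∀ k : ℕ, (k / m : ℝ) * (redGain m k true : ℕ) ^ 2 +
      (1 - k / m : ℝ) * (redGain m k false : ℕ) ^ 2 = 3 * (k : ℝ) ^ 2 + m * k := fun k => by
    simp only [redGain]; push_cast; simp; field_simp; ring
  simp only [urnMean, this]
  calc _ = 3 * ∑ k ∈ Finset.range (m + 1),
        (m.choose k * x ^ k * (1 - x) ^ (m - k) : ℝ) * (k : ℝ) ^ 2 +
        m * ∑ k ∈ Finset.range (m + 1), (m.choose k * x ^ k * (1 - x) ^ (m - k) : ℝ) * k := by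
        rw [Finset.mul_sum, Finset.mul_sum, ← Finset.sum_add_distrib]
        exact Finset.sum_congr rfl fun k _ => by ring
    _ = _ := by rw [sum_binomial_weight_mul, sum_binomial_weight_mul_sq]; ring

lemma urnMean_sub_eq_zero {m : ℕ} (hm : m ≠ 0) (x : ℝ) :
    urnMean m x (fun k c => (k : ℝ) - m * (if c then 1 else 0)) = 0 := by
  have hm' : (m : ℝ) ≠ 0 := by exact_mod_cast hm
  have : ∀ k : ℕ, (k / m : ℝ) * ((k : ℝ) - m * (if true then 1 else 0)) +
      (1 - k / m : ℝ) * ((k : ℝ) - m * (if false then 1 else 0)) = 0 := fun k => by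
    simp; field_simp; ring
  simp only [urnMean]
  exact Finset.sum_eq_zero fun k _ => mul_eq_zero_of_right _ (by simpa using this k)

lemma urnMean_redGain_centered {m : ℕ} (hm : m ≠ 0) (x : ℝ) :
    urnMean m x (fun k c => (redGain m k c : ℝ) - 2 * m * x) = 0 := by
  have h := urnMean_add m x (fun k c => (redGain m k c : ℝ)) (fun _ _ => -(2 * m * x))
  rw [urnMean_redGain hm, urnMean_const] at h
  simpa [sub_eq_add_neg] using h

/-- In units of x(1 - x), the binomial `k` has variance m, the m ends at the new node contribute m²,
and the covariance of `k` with the colour contributes 2m. -/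
lemma urnMean_redGain_centered_sq {m : ℕ} (hm : m ≠ 0) (x : ℝ) :
    urnMean m x (fun k c => ((redGain m k c : ℝ) - 2 * m * x) ^ 2) =
      (m ^ 2 + 3 * m) * (x * (1 - x)) := by
  have e : ∀ k c, ((redGain m k c : ℝ) - 2 * m * x) ^ 2 =
      (redGain m k c : ℝ) ^ 2 + ((-(4 * m * x)) * (redGain m k c : ℝ) + (2 * m * x) ^ 2) :=
    fun k c => by ring
  simp only [e]
  rw [urnMean_add, urnMean_add, urnMean_const_mul, urnMean_const, urnMean_redGain hm,
    urnMean_redGain_sq hm]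
  ring

/-- The state of the urn: total degrees of the red and of the blue nodes, and numbers of red and of
blue nodes. -/
@[ext]
structure UrnState where
  /-- total degree of the red nodes -/
  redDeg : ℕ
  /-- total degree of the blue nodes -/
  blueDeg : ℕ
  /-- number of red nodes -/
  red : ℕ
  /-- number of blue nodes -/
  blue : ℕ

namespace UrnState

instance : Countable UrnState :=
  Function.Injective.countable (f := fun s : UrnState => (s.redDeg, s.blueDeg, s.red, s.blue))
    fun s t h => by
      simp only [Prod.mk.injEq] at h
      exact UrnState.ext h.1 h.2.1 h.2.2.1 h.2.2.2

instance : MeasurableSpace UrnState := ⊤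

instance : DiscreteMeasurableSpace UrnState := ⟨fun _ => trivial⟩

/-- Total degree. -/
noncomputable def total (s : UrnState) : ℝ := s.redDeg + s.blueDeg

/-- Share of the red nodes in the total degree. -/
noncomputable def frac (s : UrnState) : ℝ := s.redDeg / s.total

/-- Number of nodes. -/
noncomputable def nodes (s : UrnState) : ℝ := s.red + s.blue

/-- The state after adding a node of colour `c`, of whose `m` edges `k` lead to red nodes. -/
def add (m : ℕ) (s : UrnState) (k : ℕ) (c : Bool) : UrnState where
  redDeg := s.redDeg + redGain m k c
  blueDeg := s.blueDeg + redGain m (m - k) (!c)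
  red := s.red + if c then 1 else 0
  blue := s.blue + if c then 0 else 1

/-- Transition probabilities of the urn in the linear model. -/
noncomputable def trans (m : ℕ) (s : UrnState) : UrnState →₀ ℝ :=
  ∑ k ∈ Finset.range (m + 1), (m.choose k * s.frac ^ k * (1 - s.frac) ^ (m - k)) •
    (Finsupp.single (s.add m k true) (k / m : ℝ) + Finsupp.single (s.add m k false) (1 - k / m : ℝ))

/-- Reduces every average over the transitions to binomial sums, without asking whether different
pairs (k, c) lead to different states. -/
lemma linearCombination_trans (m : ℕ) (s : UrnState) (f : UrnState → ℝ) :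
    Finsupp.linearCombination ℝ f (s.trans m) =
      urnMean m s.frac fun k c => f (s.add m k c) := by
  simp only [trans, urnMean, map_sum, map_smul, map_add, Finsupp.linearCombination_single,
    smul_eq_mul]

lemma frac_nonneg (s : UrnState) : 0 ≤ s.frac := by unfold frac total; positivity

lemma frac_le_one (s : UrnState) : s.frac ≤ 1 :=
  div_le_one_of_le₀ (by simp [total]) (by unfold total; positivity)

lemma trans_nonneg (m : ℕ) (s s' : UrnState) : 0 ≤ s.trans m s' := by
  classical
  have h1 := s.frac_nonneg
  have h2 := sub_nonneg.2 s.frac_le_one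
  rw [trans, Finsupp.finsetSum_apply]
  refine Finset.sum_nonneg fun k hk => ?_
  have hk : k ≤ m := by simpa [Nat.lt_succ_iff] using hk
  have hkm : (k / m : ℝ) ≤ 1 := div_le_one_of_le₀ (by exact_mod_cast hk) (by positivity)
  have := sub_nonneg.2 hkm
  rw [Finsupp.smul_apply, Finsupp.add_apply, Finsupp.single_apply, Finsupp.single_apply]
  refine smul_nonneg (by positivity) (add_nonneg ?_ ?_) <;> split_ifs <;> positivity

lemma sum_trans (m : ℕ) (s : UrnState) : ((s.trans m).sum fun _ x => x) = 1 := by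
  have := linearCombination_trans m s fun _ => 1
  rw [urnMean_const, Finsupp.linearCombination_apply] at this
  simpa using this

lemma exists_add_of_trans_ne_zero {m : ℕ} {s s' : UrnState} (h : s.trans m s' ≠ 0) :
    ∃ k ≤ m, ∃ c, s' = s.add m k c := by
  classical
  by_contra! hc
  refine h ?_
  rw [trans, Finsupp.finsetSum_apply]
  refine Finset.sum_eq_zero fun k hk => ?_
  have hk : k ≤ m := by simpa [Nat.lt_succ_iff] using hk
  rw [Finsupp.smul_apply, Finsupp.add_apply, Finsupp.single_apply, Finsupp.single_apply,
    if_neg (hc k hk _).symm, if_neg (hc k hk _).symm]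
  simp

/-- Both colours occur with positive degree. -/
def IsMixed (s : UrnState) : Prop := 0 < s.redDeg ∧ 0 < s.blueDeg

lemma IsMixed.total_ge_two {s : UrnState} (h : s.IsMixed) : 2 ≤ s.total := by
  have h1 : (1 : ℝ) ≤ s.redDeg := by exact_mod_cast h.1
  have h2 : (1 : ℝ) ≤ s.blueDeg := by exact_mod_cast h.2
  unfold total; linarith

lemma IsMixed.add {s : UrnState} (h : s.IsMixed) (m k : ℕ) (c : Bool) : (s.add m k c).IsMixed :=
  ⟨Nat.add_pos_left h.1 _, Nat.add_pos_left h.2 _⟩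

lemma total_add {m k : ℕ} (hk : k ≤ m) (s : UrnState) (c : Bool) :
    (s.add m k c).total = s.total + 2 * m := by
  cases c <;> simp [total, UrnState.add, redGain, Nat.cast_sub hk] <;> ring

lemma nodes_add (m k : ℕ) (s : UrnState) (c : Bool) : (s.add m k c).nodes = s.nodes + 1 := by
  cases c <;> simp [nodes, UrnState.add] <;> ring

lemma IsMixed.frac_add {s : UrnState} (h : s.IsMixed) {m k : ℕ} (hk : k ≤ m) (c : Bool) :
    (s.add m k c).frac = s.frac + (redGain m k c - 2 * m * s.frac) / (s.total + 2 * m) := by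
  have h2 := h.total_ge_two
  have h1 : s.total ≠ 0 := by linarith
  have h3 : s.total + 2 * m ≠ 0 := by positivity
  have h4 : s.frac * s.total = s.redDeg := by rw [frac, div_mul_cancel₀ _ h1]
  rw [frac, total_add hk]
  have : ((s.add m k c).redDeg : ℝ) = s.redDeg + redGain m k c := by simp [UrnState.add]
  rw [this, ← h4]
  field_simp
  ring

lemma abs_redGain_sub_le {m k : ℕ} (hk : k ≤ m) (s : UrnState) (c : Bool) :
    |(redGain m k c : ℝ) - 2 * m * s.frac| ≤ 2 * m := by
  have h1 := s.frac_nonneg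
  have h2 := s.frac_le_one
  have hk' : (k : ℝ) ≤ m := by exact_mod_cast hk
  have h3 : (redGain m k c : ℝ) ≤ 2 * m := by
    cases c <;> simp [redGain] <;> linarith
  have h4 : (0 : ℝ) ≤ m := by positivity
  have h5 : (0 : ℝ) ≤ redGain m k c := by positivity
  rw [abs_le]
  constructor <;> nlinarith

variable {m : ℕ} {s : UrnState}

lemma IsMixed.mean_frac (hs : s.IsMixed) (hm : m ≠ 0) :
    Finsupp.linearCombination ℝ frac (s.trans m) = s.frac := by
  rw [linearCombination_trans]
  have e : ∀ k ≤ m, ∀ c, (s.add m k c).frac =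
      s.frac + (s.total + 2 * m)⁻¹ * (redGain m k c - 2 * m * s.frac) := fun k hk c => by
    rw [hs.frac_add hk, div_eq_inv_mul]
  rw [urnMean_congr _ e, urnMean_add, urnMean_const, urnMean_const_mul,
    urnMean_redGain_centered hm, mul_zero, add_zero]

/-- Averages of quadratic functions of the share of red. -/
lemma IsMixed.mean_quadratic (hs : s.IsMixed) (hm : m ≠ 0) (a b c : ℝ) :
    Finsupp.linearCombination ℝ
      (fun t => a + b * (t.frac - s.frac) + c * (t.frac - s.frac) ^ 2) (s.trans m) =
      a + c * ((m ^ 2 + 3 * m) * (s.frac * (1 - s.frac)) / (s.total + 2 * m) ^ 2) := by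
  rw [linearCombination_trans]
  have e : ∀ k ≤ m, ∀ d, a + b * ((s.add m k d).frac - s.frac) +
      c * ((s.add m k d).frac - s.frac) ^ 2 =
      (a + (b * (s.total + 2 * m)⁻¹) * (redGain m k d - 2 * m * s.frac)) +
        (c * ((s.total + 2 * m)⁻¹) ^ 2) * (redGain m k d - 2 * m * s.frac) ^ 2 := fun k hk d => by
    rw [hs.frac_add hk, div_eq_inv_mul]; ring
  rw [urnMean_congr _ e, urnMean_add, urnMean_add, urnMean_const, urnMean_const_mul,
    urnMean_const_mul, urnMean_redGain_centered hm, urnMean_redGain_centered_sq hm]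
  rw [div_eq_mul_inv, inv_pow]
  ring

/-- One step changes the mean of `x (1 - x)` by the conditional variance. -/
lemma IsMixed.mean_frac_mul_one_sub (hs : s.IsMixed) (hm : m ≠ 0) :
    Finsupp.linearCombination ℝ (fun t => t.frac * (1 - t.frac)) (s.trans m) =
      (1 - (m ^ 2 + 3 * m) / (s.total + 2 * m) ^ 2) * (s.frac * (1 - s.frac)) := by
  have h := hs.mean_quadratic hm (s.frac * (1 - s.frac)) (1 - 2 * s.frac) (-1)
  have e : (fun t : UrnState => t.frac * (1 - t.frac)) = fun t => s.frac * (1 - s.frac) +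
      (1 - 2 * s.frac) * (t.frac - s.frac) + -1 * (t.frac - s.frac) ^ 2 := by
    funext t; ring
  rw [e, h]
  ring

lemma IsMixed.mean_sq_sub (hs : s.IsMixed) (hm : m ≠ 0) (r : ℝ) :
    Finsupp.linearCombination ℝ (fun t => (t.frac - r) ^ 2) (s.trans m) =
      (s.frac - r) ^ 2 +
        (m ^ 2 + 3 * m) / (s.total + 2 * m) ^ 2 * (s.frac * (1 - s.frac)) := by
  have h := hs.mean_quadratic hm ((s.frac - r) ^ 2) (2 * (s.frac - r)) 1
  have e : (fun t : UrnState => (t.frac - r) ^ 2) = fun t => (s.frac - r) ^ 2 +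
      2 * (s.frac - r) * (t.frac - s.frac) + 1 * (t.frac - s.frac) ^ 2 := by
    funext t; ring
  rw [e, h]
  ring

lemma linearCombination_trans_mono {f g : UrnState → ℝ}
    (h : ∀ k ≤ m, ∀ c, f (s.add m k c) ≤ g (s.add m k c)) :
    Finsupp.linearCombination ℝ f (s.trans m) ≤ Finsupp.linearCombination ℝ g (s.trans m) := by
  rw [linearCombination_trans, linearCombination_trans]
  exact urnMean_mono s.frac_nonneg s.frac_le_one h

/-- In (w + d)⁴ the cubic term satisfies 4wd³ ≤ 2w²d² + 2d⁴, leaving 8w²d² + 3d⁴ beside w⁴ + 4w³d.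
One factor d² of d⁴ is bounded by (2m / (total + 2m))², so what remains is quadratic in d and
`mean_quadratic` applies. -/
lemma IsMixed.mean_fourth_le (hs : s.IsMixed) (hm : m ≠ 0) (r : ℝ) :
    Finsupp.linearCombination ℝ (fun t => (t.frac - r) ^ 4) (s.trans m) ≤
      (s.frac - r) ^ 4 + (8 * (s.frac - r) ^ 2 + 12 * m ^ 2 / (s.total + 2 * m) ^ 2) *
        ((m ^ 2 + 3 * m) * (s.frac * (1 - s.frac)) / (s.total + 2 * m) ^ 2) := by
  rw [← hs.mean_quadratic hm ((s.frac - r) ^ 4) (4 * (s.frac - r) ^ 3)]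
  refine linearCombination_trans_mono fun k hk c => ?_
  set w := s.frac - r
  have hD : 0 < s.total + 2 * m := by have := hs.total_ge_two; positivity
  set d := (s.add m k c).frac - s.frac with hd
  have e : (s.add m k c).frac - r = w + d := by simp only [w, d]; ring
  have hd2 : d ^ 2 ≤ 4 * m ^ 2 / (s.total + 2 * m) ^ 2 := by
    have : d = (redGain m k c - 2 * m * s.frac) / (s.total + 2 * m) := by
      rw [hd, hs.frac_add hk]; ring
    rw [this, div_pow]
    gcongr
    calc _ ≤ (2 * (m : ℝ)) ^ 2 := sq_le_sq.2 (by
            rw [abs_of_nonneg (by positivity : (0 : ℝ) ≤ 2 * m)]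
            exact abs_redGain_sub_le hk s c)
      _ = _ := by ring
  rw [e]
  have h12 : 12 * (m : ℝ) ^ 2 / (s.total + 2 * m) ^ 2 = 3 * (4 * m ^ 2 / (s.total + 2 * m) ^ 2) := by
    ring
  rw [h12]
  nlinarith [mul_nonneg (sq_nonneg d) (sub_nonneg.2 hd2), sq_nonneg (d * (w - d)),
    mul_nonneg (sq_nonneg d) (sq_nonneg (w - d))]

end UrnState

end UrnStep

/-! ### Second and fourth moments of the red share, uniformly in time. -/

section UrnMoments

variable {Ω : Type*} [mΩ : MeasurableSpace Ω] {P : Measure Ω} [IsProbabilityMeasure P]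
  {m : ℕ} {s₀ : UrnState} {U : ℕ → Ω → UrnState}

namespace IsMarkovChain

/-- The total degree and the number of nodes are deterministic, so their reciprocals can be taken
out of expectations. -/
lemma ae_urn (h : IsMarkovChain (UrnState.trans m) s₀ P U) (hs : s₀.IsMixed) :
    ∀ᵐ ω ∂P, ∀ n, (U n ω).IsMixed ∧ (U n ω).total = s₀.total + 2 * m * n ∧
      (U n ω).nodes = s₀.nodes + n := by
  filter_upwards [h.init, h.ae_mem_support] with ω h0 h1 n
  induction n with
  | zero => simp [h0, hs]
  | succ n ih =>
    obtain ⟨k, hk, c, e⟩ := UrnState.exists_add_of_trans_ne_zero (h1 n)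
    rw [e, UrnState.total_add hk, UrnState.nodes_add, ih.2.1, ih.2.2]
    exact ⟨ih.1.add m k c, by push_cast; ring, by push_cast; ring⟩

lemma martingale_frac (h : IsMarkovChain (UrnState.trans m) s₀ P U) (hm : m ≠ 0)
    (hs : s₀.IsMixed) :
    Martingale (fun n ω => (U n ω).frac) (historyFiltration h.measurable) P :=
  h.martingale UrnState.frac fun n => by
    filter_upwards [h.ae_urn hs] with ω hω using (hω n).1.mean_frac hm

lemma integral_init (h : IsMarkovChain (UrnState.trans m) s₀ P U) (f : UrnState → ℝ) :
    ∫ ω, f (U 0 ω) ∂P = f s₀ := by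
  have : (fun ω => f (U 0 ω)) =ᵐ[P] fun _ => f s₀ := by
    filter_upwards [h.init] with ω hω; rw [hω]
  rw [integral_congr_ae this]; simp

lemma integral_frac (h : IsMarkovChain (UrnState.trans m) s₀ P U) (hm : m ≠ 0)
    (hs : s₀.IsMixed) (n : ℕ) : ∫ ω, (U n ω).frac ∂P = s₀.frac := by
  induction n with
  | zero => exact h.integral_init UrnState.frac
  | succ n ih =>
    rw [h.integral_succ n UrnState.frac, ← ih]
    refine integral_congr_ae ?_
    filter_upwards [h.ae_urn hs] with ω hω using (hω n).1.mean_frac hm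

lemma integral_frac_mul_one_sub_succ (h : IsMarkovChain (UrnState.trans m) s₀ P U) (hm : m ≠ 0)
    (hs : s₀.IsMixed) (n : ℕ) :
    ∫ ω, (U (n + 1) ω).frac * (1 - (U (n + 1) ω).frac) ∂P =
      (1 - (m ^ 2 + 3 * m) / (s₀.total + 2 * m * (n + 1)) ^ 2) *
        ∫ ω, (U n ω).frac * (1 - (U n ω).frac) ∂P := by
  rw [h.integral_succ n fun s => s.frac * (1 - s.frac), ← integral_const_mul]
  refine integral_congr_ae ?_
  filter_upwards [h.ae_urn hs] with ω hω
  rw [(hω n).1.mean_frac_mul_one_sub hm, (hω n).2.1]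
  ring

lemma integral_sq_sub_succ (h : IsMarkovChain (UrnState.trans m) s₀ P U) (hm : m ≠ 0)
    (hs : s₀.IsMixed) (n : ℕ) (r : ℝ) :
    ∫ ω, ((U (n + 1) ω).frac - r) ^ 2 ∂P = ∫ ω, ((U n ω).frac - r) ^ 2 ∂P +
      (m ^ 2 + 3 * m) / (s₀.total + 2 * m * (n + 1)) ^ 2 *
        ∫ ω, (U n ω).frac * (1 - (U n ω).frac) ∂P := by
  rw [h.integral_succ n fun s => (s.frac - r) ^ 2, ← integral_const_mul, ← integral_add
    (h.integrable n fun s => (s.frac - r) ^ 2)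
    (h.integrable n fun s => (m ^ 2 + 3 * m) / (s₀.total + 2 * m * (n + 1)) ^ 2 *
      (s.frac * (1 - s.frac)))]
  refine integral_congr_ae ?_
  filter_upwards [h.ae_urn hs] with ω hω
  rw [(hω n).1.mean_sq_sub hm, (hω n).2.1]
  ring

end IsMarkovChain

namespace UrnState

lemma IsMixed.total_pos {s : UrnState} (h : s.IsMixed) : 0 < s.total := by
  have := h.total_ge_two; linarith

/-- Both degrees are integers at least 1, so X + Y ≤ 2XY. The bound lets 1/D be traded for x(1 - x)
even when x is close to 0 or 1. -/
lemma IsMixed.inv_total_le {s : UrnState} (h : s.IsMixed) :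
    1 / s.total ≤ 2 * (s.frac * (1 - s.frac)) := by
  have hD := h.total_pos
  have h2 := h.total_ge_two
  have h1 : (1 : ℝ) ≤ s.redDeg := by exact_mod_cast h.1
  have h1' : (1 : ℝ) ≤ s.blueDeg := by exact_mod_cast h.2
  have e : s.frac * (1 - s.frac) = s.redDeg * s.blueDeg / s.total ^ 2 := by
    rw [frac]; field_simp; simp [total]
  rw [e, ← mul_div_assoc, div_le_div_iff₀ hD (by positivity)]
  have : s.total ≤ 2 * (s.redDeg * s.blueDeg) := by
    have : s.total = s.redDeg + s.blueDeg := rfl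
    nlinarith
  nlinarith

lemma IsMixed.frac_mul_one_sub_pos {s : UrnState} (h : s.IsMixed) : 0 < s.frac * (1 - s.frac) := by
  have := h.inv_total_le
  have : 0 < 1 / s.total := by have := h.total_pos; positivity
  linarith

lemma frac_mul_one_sub_nonneg (s : UrnState) : 0 ≤ s.frac * (1 - s.frac) :=
  mul_nonneg s.frac_nonneg (sub_nonneg.2 s.frac_le_one)

end UrnState

/-- Telescoping bound for the sum of the reciprocal squares of the total degrees. -/
lemma one_div_sq_le_sub {D μ : ℝ} (hD : 0 < D) (hμ : 0 < μ) :
    1 / (D + μ) ^ 2 ≤ (1 / D - 1 / (D + μ)) / μ := by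
  have h : (1 / D - 1 / (D + μ)) / μ = 1 / (D * (D + μ)) := by field_simp; ring
  rw [h]
  gcongr
  nlinarith

namespace IsMarkovChain

section

variable (h : IsMarkovChain (UrnState.trans m) s₀ P U) (hm : m ≠ 0) (hs : s₀.IsMixed)

include h

lemma integral_frac_mul_one_sub_nonneg (n : ℕ) :
    0 ≤ ∫ ω, (U n ω).frac * (1 - (U n ω).frac) ∂P :=
  integral_nonneg fun ω => (U n ω).frac_mul_one_sub_nonneg

include hm hs

/-- A step from total degree D multiplies the mean by 1 - q with q ≥ (1/D - 1/(D + 2m))/2. Since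
`s₀.total ≥ 2`, the bound so far keeps more than half of the initial value, so each step loses at
least a quarter of the telescoping difference. -/
lemma integral_frac_mul_one_sub_le (n : ℕ) :
    ∫ ω, (U n ω).frac * (1 - (U n ω).frac) ∂P ≤ s₀.frac * (1 - s₀.frac) *
      (1 - (1 / s₀.total - 1 / (s₀.total + 2 * m * n)) / 4) := by
  have hD := hs.total_ge_two
  have hm1 : (1 : ℝ) ≤ m := by exact_mod_cast Nat.one_le_iff_ne_zero.2 hm
  induction n with
  | zero => rw [h.integral_init fun s => s.frac * (1 - s.frac)]; simp
  | succ n ih =>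
    rw [h.integral_frac_mul_one_sub_succ hm hs]
    set D := s₀.total + 2 * m * n with hDn
    have hDD : s₀.total ≤ D := by simp only [hDn]; linarith [show (0 : ℝ) ≤ 2 * m * n by positivity]
    have e1 : s₀.total + 2 * m * (n + 1) = D + 2 * m := by simp only [hDn]; ring
    have e2 : s₀.total + 2 * m * ((n + 1 : ℕ) : ℝ) = D + 2 * m := by rw [← e1]; push_cast; ring
    rw [e1, e2]
    have hD0 : 0 < D := by linarith
    have hu := hs.frac_mul_one_sub_pos
    have hq : (m ^ 2 + 3 * m : ℝ) / (D + 2 * m) ^ 2 ≤ 1 := by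
      rw [div_le_one (by positivity)]; nlinarith
    refine (mul_le_mul_of_nonneg_left ih (sub_nonneg.2 hq)).trans ?_
    rw [mul_left_comm]
    refine mul_le_mul_of_nonneg_left ?_ hu.le
    have hr : 1 / s₀.total ≤ 1 / 2 := one_div_le_one_div_of_le (by norm_num) hD
    have h1 : 0 < 1 / D := by positivity
    have h2 : 1 / D - 1 / (D + 2 * m) ≤ 2 * ((m ^ 2 + 3 * m) / (D + 2 * m) ^ 2) := by
      have : 1 / D - 1 / (D + 2 * m) = 2 * m / (D * (D + 2 * m)) := by field_simp; ring
      rw [this, ← mul_div_assoc, div_le_div_iff₀ (by positivity) (by positivity)]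
      have h3 : (m : ℝ) * (D + 2 * m) ≤ (m ^ 2 + 3 * m) * D := by nlinarith
      have h4 : 0 < D + 2 * m := by positivity
      nlinarith
    have h5 : 0 ≤ (m ^ 2 + 3 * m : ℝ) / (D + 2 * m) ^ 2 := by positivity
    nlinarith

/-- For a martingale in [0, 1], the variance gained is exactly the mean of x(1 - x) lost. -/
lemma integral_sq_add (n : ℕ) :
    ∫ ω, ((U n ω).frac - s₀.frac) ^ 2 ∂P + ∫ ω, (U n ω).frac * (1 - (U n ω).frac) ∂P =
      s₀.frac * (1 - s₀.frac) := by
  induction n with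
  | zero =>
    rw [h.integral_init fun s => s.frac * (1 - s.frac), h.integral_init fun s =>
      (s.frac - s₀.frac) ^ 2]
    ring
  | succ n ih =>
    rw [h.integral_frac_mul_one_sub_succ hm hs, h.integral_sq_sub_succ hm hs, ← ih]
    ring

lemma le_integral_sq (n : ℕ) :
    s₀.frac * (1 - s₀.frac) * ((1 / s₀.total - 1 / (s₀.total + 2 * m * n)) / 4) ≤
      ∫ ω, ((U n ω).frac - s₀.frac) ^ 2 ∂P := by
  have h1 := h.integral_sq_add hm hs n
  have h2 := h.integral_frac_mul_one_sub_le hm hs n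
  linarith

lemma integral_frac_mul_one_sub_le_init (n : ℕ) :
    ∫ ω, (U n ω).frac * (1 - (U n ω).frac) ∂P ≤ s₀.frac * (1 - s₀.frac) := by
  have h1 := h.integral_sq_add hm hs n
  have : 0 ≤ ∫ ω, ((U n ω).frac - s₀.frac) ^ 2 ∂P := integral_nonneg fun ω => sq_nonneg _
  linarith

/-- The step variances telescope by `one_div_sq_le_sub` with increment 2m, whence the factor (m² +
3m)/(2m) = (m + 3)/2. -/
lemma integral_sq_le_sub (n : ℕ) :
    ∫ ω, ((U n ω).frac - s₀.frac) ^ 2 ∂P ≤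
      (m + 3) / 2 * (s₀.frac * (1 - s₀.frac)) *
        (1 / s₀.total - 1 / (s₀.total + 2 * m * n)) := by
  have hD := hs.total_pos
  have hm1 : (1 : ℝ) ≤ m := by exact_mod_cast Nat.one_le_iff_ne_zero.2 hm
  induction n with
  | zero => rw [h.integral_init fun s => (s.frac - s₀.frac) ^ 2]; simp
  | succ n ih =>
    rw [h.integral_sq_sub_succ hm hs]
    have e1 : s₀.total + 2 * m * ((n : ℝ) + 1) = (s₀.total + 2 * m * n) + 2 * m := by ring
    push_cast
    rw [e1]
    have hD0 : 0 < s₀.total + 2 * m * n := by positivity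
    have h1 := one_div_sq_le_sub hD0 (by positivity : (0 : ℝ) < 2 * m)
    set D := s₀.total + 2 * m * n
    set u := s₀.frac * (1 - s₀.frac) with hu
    have hu0 : 0 ≤ u := s₀.frac_mul_one_sub_nonneg
    have h2 := h.integral_frac_mul_one_sub_le_init hm hs n
    calc _ ≤ (m + 3) / 2 * u * (1 / s₀.total - 1 / D) +
          (m ^ 2 + 3 * m) / (D + 2 * m) ^ 2 * u := by gcongr
      _ = (m + 3) / 2 * u * (1 / s₀.total - 1 / D) +
          (m ^ 2 + 3 * m) * u * (1 / (D + 2 * m) ^ 2) := by ring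
      _ ≤ (m + 3) / 2 * u * (1 / s₀.total - 1 / D) +
          (m ^ 2 + 3 * m) * u * ((1 / D - 1 / (D + 2 * m)) / (2 * m)) := by gcongr
      _ = _ := by field_simp; ring

lemma integral_sq_le (n : ℕ) :
    ∫ ω, ((U n ω).frac - s₀.frac) ^ 2 ∂P ≤
      (m + 3) / 2 * (s₀.frac * (1 - s₀.frac) / s₀.total) := by
  refine (h.integral_sq_le_sub hm hs n).trans ?_
  have hD := hs.total_pos
  have hu0 := s₀.frac_mul_one_sub_nonneg
  have : 0 ≤ 1 / (s₀.total + 2 * m * n) := by positivity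
  rw [mul_assoc, div_eq_mul_one_div (s₀.frac * (1 - s₀.frac))]
  gcongr
  linarith

end

end IsMarkovChain

/-- Constant in the fourth moment bound for the urn. -/
noncomputable def fourthMomentConst (m : ℕ) : ℝ :=
  (m + 3) * (4 * (m + 3) + 16 * (m + 3) ^ 2 + 24 * m ^ 2)

lemma fourthMomentConst_nonneg (m : ℕ) : 0 ≤ fourthMomentConst m := by
  unfold fourthMomentConst; positivity

/-- Pointwise bound used to control `(x - x₀)² x (1 - x)`. -/
lemma sq_mul_le_of_mem_unitInterval {x y u θ : ℝ} (hx0 : 0 ≤ x) (hx1 : x ≤ 1) (hy0 : 0 ≤ y)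
    (hy1 : y ≤ 1) (hu : u = y * (1 - y)) (hu0 : 0 < u) (hθ : 0 < θ) :
    (x - y) ^ 2 * (x * (1 - x)) ≤
      (u + θ * u / 2) * (x - y) ^ 2 + 1 / (2 * (θ * u)) * (x - y) ^ 4 := by
  have h1 : x * (1 - x) ≤ u + |x - y| := by
    rw [hu]
    rcases abs_cases (x - y) with ⟨h, _⟩ | ⟨h, _⟩ <;> rw [h] <;> nlinarith
  have hw : 0 < θ * u := by positivity
  have h2 : |x - y| ≤ θ * u / 2 + 1 / (2 * (θ * u)) * (x - y) ^ 2 := by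
    have : θ * u / 2 + 1 / (2 * (θ * u)) * (x - y) ^ 2 - |x - y| =
        (θ * u - |x - y|) ^ 2 / (2 * (θ * u)) := by
      rw [← sq_abs (x - y)]; field_simp; ring
    have : 0 ≤ (θ * u - |x - y|) ^ 2 / (2 * (θ * u)) := by positivity
    linarith
  calc _ ≤ (x - y) ^ 2 * (u + (θ * u / 2 + 1 / (2 * (θ * u)) * (x - y) ^ 2)) := by
        gcongr; linarith
    _ = _ := by ring

namespace IsMarkovChain

variable (h : IsMarkovChain (UrnState.trans m) s₀ P U) (hm : m ≠ 0) (hs : s₀.IsMixed)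

include h hm hs

lemma integral_fourth_succ_le (n : ℕ) {θ : ℝ} (hθ : 0 < θ) :
    ∫ ω, ((U (n + 1) ω).frac - s₀.frac) ^ 4 ∂P ≤ ∫ ω, ((U n ω).frac - s₀.frac) ^ 4 ∂P +
      (m ^ 2 + 3 * m) / (s₀.total + 2 * m * (n + 1)) ^ 2 *
      (8 * ((s₀.frac * (1 - s₀.frac) + θ * (s₀.frac * (1 - s₀.frac)) / 2) *
          ∫ ω, ((U n ω).frac - s₀.frac) ^ 2 ∂P +
        1 / (2 * (θ * (s₀.frac * (1 - s₀.frac)))) * ∫ ω, ((U n ω).frac - s₀.frac) ^ 4 ∂P) +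
      12 * m ^ 2 / (s₀.total + 2 * m * (n + 1)) ^ 2 *
        ∫ ω, (U n ω).frac * (1 - (U n ω).frac) ∂P) := by
  set u := s₀.frac * (1 - s₀.frac) with hu
  set D := s₀.total + 2 * m * (n + 1) with hD
  have hu0 : 0 < u := hs.frac_mul_one_sub_pos
  rw [h.integral_succ n fun s => (s.frac - s₀.frac) ^ 4]
  have i2 := h.integrable n fun s => (s.frac - s₀.frac) ^ 2
  have i4 := h.integrable n fun s => (s.frac - s₀.frac) ^ 4
  have iu := h.integrable n fun s => s.frac * (1 - s.frac)
  have key : ∀ᵐ ω ∂P, Finsupp.linearCombination ℝ (fun s : UrnState => (s.frac - s₀.frac) ^ 4)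
      ((U n ω).trans m) ≤ ((U n ω).frac - s₀.frac) ^ 4 + (m ^ 2 + 3 * m) / D ^ 2 *
      (8 * ((u + θ * u / 2) * ((U n ω).frac - s₀.frac) ^ 2 +
        1 / (2 * (θ * u)) * ((U n ω).frac - s₀.frac) ^ 4) +
      12 * m ^ 2 / D ^ 2 * ((U n ω).frac * (1 - (U n ω).frac))) := by
    filter_upwards [h.ae_urn hs] with ω hω
    have h1 := (hω n).1.mean_fourth_le hm s₀.frac
    have e : (U n ω).total + 2 * m = D := by rw [(hω n).2.1, hD]; ring
    rw [e] at h1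
    have h2 := sq_mul_le_of_mem_unitInterval (U n ω).frac_nonneg (U n ω).frac_le_one
      s₀.frac_nonneg s₀.frac_le_one hu hu0 hθ
    refine h1.trans ?_
    set x := (U n ω).frac
    calc _ = (x - s₀.frac) ^ 4 + (m ^ 2 + 3 * m) / D ^ 2 * (8 * ((x - s₀.frac) ^ 2 * (x * (1 - x)))
          + 12 * m ^ 2 / D ^ 2 * (x * (1 - x))) := by ring
      _ ≤ _ := by gcongr
  refine (integral_mono_ae (h.integrable n fun s => Finsupp.linearCombination ℝ
    (fun s : UrnState => (s.frac - s₀.frac) ^ 4) (s.trans m)) ?_ key).trans (le_of_eq ?_)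
  · exact h.integrable n fun s => (s.frac - s₀.frac) ^ 4 + (m ^ 2 + 3 * m) / D ^ 2 *
      (8 * ((u + θ * u / 2) * (s.frac - s₀.frac) ^ 2 + 1 / (2 * (θ * u)) * (s.frac - s₀.frac) ^ 4) +
      12 * m ^ 2 / D ^ 2 * (s.frac * (1 - s.frac)))
  · rw [integral_add i4 (h.integrable n fun s => (m ^ 2 + 3 * m) / D ^ 2 *
      (8 * ((u + θ * u / 2) * (s.frac - s₀.frac) ^ 2 + 1 / (2 * (θ * u)) * (s.frac - s₀.frac) ^ 4) +
      12 * m ^ 2 / D ^ 2 * (s.frac * (1 - s.frac)))), integral_const_mul,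
      integral_add (h.integrable n fun s => 8 * ((u + θ * u / 2) * (s.frac - s₀.frac) ^ 2 +
        1 / (2 * (θ * u)) * (s.frac - s₀.frac) ^ 4)) (iu.const_mul _), integral_const_mul,
      integral_add (i2.const_mul _) (i4.const_mul _), integral_const_mul, integral_const_mul,
      integral_const_mul]

lemma integral_fourth_le_sub (n : ℕ) :
    ∫ ω, ((U n ω).frac - s₀.frac) ^ 4 ∂P ≤ fourthMomentConst m *
      (s₀.frac * (1 - s₀.frac)) ^ 2 / s₀.total * (1 / s₀.total - 1 / (s₀.total + 2 * m * n)) := by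
  have hD := hs.total_pos
  have hm1 : (1 : ℝ) ≤ m := by exact_mod_cast Nat.one_le_iff_ne_zero.2 hm
  have hK := fourthMomentConst_nonneg m
  induction n with
  | zero => rw [h.integral_init fun s => (s.frac - s₀.frac) ^ 4]; simp
  | succ n ih =>
    -- With this θ, the contribution of the fourth moment to its own increment is half of what the
    -- induction allows; `fourthMomentConst` is chosen so that the other terms make up exactly the
    -- other half (`b4`).
    have hθ : (0 : ℝ) < 8 * (m + 3) := by positivity
    refine (h.integral_fourth_succ_le hm hs n hθ).trans ?_
    have hv := h.integral_sq_le hm hs n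
    have he := h.integral_frac_mul_one_sub_le_init hm hs n
    have he0 := h.integral_frac_mul_one_sub_nonneg n
    have hi := hs.inv_total_le
    have hu0 := hs.frac_mul_one_sub_pos
    have e1 : s₀.total + 2 * m * ((n : ℝ) + 1) = (s₀.total + 2 * m * n) + 2 * m := by ring
    have hD0 : 0 < s₀.total + 2 * m * n := by positivity
    have hDn : s₀.total ≤ s₀.total + 2 * m * n := by
      linarith [show (0 : ℝ) ≤ 2 * m * n by positivity]
    have h1 := one_div_sq_le_sub hD0 (by positivity : (0 : ℝ) < 2 * m)
    push_cast
    rw [e1]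
    set K := fourthMomentConst m with hKdef
    set u := s₀.frac * (1 - s₀.frac)
    set D := s₀.total
    set E := D + 2 * m * n
    set v := ∫ ω, ((U n ω).frac - s₀.frac) ^ 2 ∂P
    set e := ∫ ω, (U n ω).frac * (1 - (U n ω).frac) ∂P
    set t := ∫ ω, ((U n ω).frac - s₀.frac) ^ 4 ∂P
    -- The induction hypothesis weakened by 1/D ≤ 2u; the extra u cancels the 1/u in front of the
    -- fourth moment.
    have ht : t ≤ K * u ^ 2 / D * (2 * u) := by
      refine ih.trans ?_
      gcongr
      have : 0 ≤ 1 / E := by positivity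
      linarith
    have b1 : (u + 8 * (m + 3) * u / 2) * v ≤
        (u + 8 * (m + 3) * u / 2) * ((m + 3) / 2 * (u / D)) := by gcongr
    have b2 : 1 / (2 * (8 * (m + 3) * u)) * t ≤
        1 / (2 * (8 * (m + 3) * u)) * (K * u ^ 2 / D * (2 * u)) := by gcongr
    have b3 : 12 * m ^ 2 / (E + 2 * m) ^ 2 * e ≤ 24 * m ^ 2 * (u ^ 2 / D) := by
      have : 1 / (E + 2 * m) ^ 2 ≤ 2 * u * (1 / D) :=
        calc 1 / (E + 2 * m) ^ 2 ≤ 1 / D ^ 2 := by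
              gcongr; linarith
          _ = 1 / D * (1 / D) := by field_simp
          _ ≤ _ := by gcongr
      calc _ = 12 * m ^ 2 * (1 / (E + 2 * m) ^ 2) * e := by ring
        _ ≤ 12 * m ^ 2 * (2 * u * (1 / D)) * u := by gcongr
        _ = _ := by ring
    have b4 : (m ^ 2 + 3 * m) * (8 * ((u + 8 * (m + 3) * u / 2) * ((m + 3) / 2 * (u / D)) +
        1 / (2 * (8 * (m + 3) * u)) * (K * u ^ 2 / D * (2 * u))) + 24 * m ^ 2 * (u ^ 2 / D)) =
        2 * m * (K * u ^ 2 / D) := by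
      rw [hKdef]
      unfold fourthMomentConst
      field_simp
      ring
    calc _ ≤ K * u ^ 2 / D * (1 / D - 1 / E) + (m ^ 2 + 3 * m) / (E + 2 * m) ^ 2 *
          (8 * ((u + 8 * (m + 3) * u / 2) * ((m + 3) / 2 * (u / D)) +
            1 / (2 * (8 * (m + 3) * u)) * (K * u ^ 2 / D * (2 * u))) + 24 * m ^ 2 * (u ^ 2 / D)) := by
          gcongr
      _ = K * u ^ 2 / D * (1 / D - 1 / E) + 2 * m * (K * u ^ 2 / D) * (1 / (E + 2 * m) ^ 2) := by
          rw [← b4]; ring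
      _ ≤ K * u ^ 2 / D * (1 / D - 1 / E) +
          2 * m * (K * u ^ 2 / D) * ((1 / E - 1 / (E + 2 * m)) / (2 * m)) := by gcongr
      _ = _ := by field_simp; ring

end IsMarkovChain

end UrnMoments

/-! ### The limit of the red share, its moments, and the absence of atoms. -/

section UrnLimit

open ProbabilityTheory

variable {Ω : Type*} [mΩ : MeasurableSpace Ω] {P : Measure Ω} [IsProbabilityMeasure P]
  {m : ℕ} {s₀ : UrnState} {U : ℕ → Ω → UrnState}

lemma tendsto_one_div_add_mul_natCast (hm : m ≠ 0) (D : ℝ) :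
    Tendsto (fun n : ℕ => 1 / (D + 2 * m * (n : ℝ))) atTop (𝓝 0) := by
  have hm' : (0 : ℝ) < 2 * m := by positivity
  have h : Tendsto (fun n : ℕ => D + 2 * m * (n : ℝ)) atTop atTop :=
    tendsto_atTop_add_const_left _ _ (tendsto_natCast_atTop_atTop.const_mul_atTop hm')
  simpa [Function.comp_def] using tendsto_inv_atTop_zero.comp h

/-- An `L¹`-bounded submartingale has an almost sure limit that is measurable with respect to the
filtration. -/
lemma exists_stronglyMeasurable_ae_tendsto {ℱ : Filtration ℕ mΩ} {f : ℕ → Ω → ℝ}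
    (hf : Submartingale f ℱ P) {R : NNReal} (hR : ∀ n, eLpNorm (f n) 1 P ≤ R) :
    ∃ L : Ω → ℝ, StronglyMeasurable[⨆ n, ℱ n] L ∧
      ∀ᵐ ω ∂P, Tendsto (fun n => f n ω) atTop (𝓝 (L ω)) :=
  have h := hf.ae_tendsto_limitProcess
  ⟨_, Filtration.stronglyMeasurable_limitProcess, h hR⟩

namespace IsMarkovChain

/-- Measurability with respect to the σ-algebra generated by the whole process is what Lévy's upward
theorem requires in `measure_limit_eq_zero`. -/
lemma exists_limit_frac (h : IsMarkovChain (UrnState.trans m) s₀ P U) (hm : m ≠ 0)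
    (hs : s₀.IsMixed) : ∃ L : Ω → ℝ,
      StronglyMeasurable[⨆ n, historyFiltration h.measurable n] L ∧
      ∀ᵐ ω ∂P, Tendsto (fun n => (U n ω).frac) atTop (𝓝 (L ω)) := by
  refine exists_stronglyMeasurable_ae_tendsto (h.martingale_frac hm hs).submartingale (R := 1)
    fun n => ?_
  refine (eLpNorm_le_of_ae_bound (C := 1) (ae_of_all _ fun ω => ?_)).trans (by simp)
  rw [Real.norm_eq_abs, abs_of_nonneg (U n ω).frac_nonneg]
  exact (U n ω).frac_le_one

section

variable (h : IsMarkovChain (UrnState.trans m) s₀ P U) {L : Ω → ℝ}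
  (hL : ∀ᵐ ω ∂P, Tendsto (fun n => (U n ω).frac) atTop (𝓝 (L ω)))

include h hL

lemma aemeasurable_limit : AEMeasurable L P :=
  aemeasurable_of_tendsto_metrizable_ae atTop
    (fun n => ((measurable_of_countable UrnState.frac).comp (h.measurable n)).aemeasurable) hL

lemma ae_limit_mem_Icc : ∀ᵐ ω ∂P, L ω ∈ Set.Icc (0 : ℝ) 1 := by
  filter_upwards [hL] with ω hω
  exact isClosed_Icc.mem_of_tendsto hω
    (Eventually.of_forall fun n => ⟨(U n ω).frac_nonneg, (U n ω).frac_le_one⟩)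

lemma integrable_limit {g : ℝ → ℝ} (hg : Continuous g) : Integrable (fun ω => g (L ω)) P := by
  obtain ⟨C, hC⟩ := isCompact_Icc.exists_bound_of_continuousOn (s := Set.Icc (0 : ℝ) 1)
    hg.continuousOn
  refine Integrable.of_bound (hg.measurable.comp_aemeasurable
    (h.aemeasurable_limit hL)).aestronglyMeasurable C ?_
  filter_upwards [h.ae_limit_mem_Icc hL] with ω hω using hC _ hω

lemma tendsto_integral_frac {g : ℝ → ℝ} (hg : Continuous g) :
    Tendsto (fun n => ∫ ω, g (U n ω).frac ∂P) atTop (𝓝 (∫ ω, g (L ω) ∂P)) := by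
  obtain ⟨C, hC⟩ := isCompact_Icc.exists_bound_of_continuousOn (s := Set.Icc (0 : ℝ) 1)
    hg.continuousOn
  refine tendsto_integral_of_dominated_convergence (fun _ => C)
    (fun n => (h.integrable n fun s => g s.frac).aestronglyMeasurable) (integrable_const C)
    (fun n => ae_of_all _ fun ω => hC _ ⟨(U n ω).frac_nonneg, (U n ω).frac_le_one⟩) ?_
  filter_upwards [hL] with ω hω using (hg.tendsto _).comp hω

variable (hm : m ≠ 0) (hs : s₀.IsMixed)

include hm hs

lemma integral_limit : ∫ ω, L ω ∂P = s₀.frac := by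
  refine tendsto_nhds_unique (h.tendsto_integral_frac hL continuous_id) ?_
  simp only [id, h.integral_frac hm hs]
  exact tendsto_const_nhds

lemma integral_limit_sq_le :
    ∫ ω, (L ω - s₀.frac) ^ 2 ∂P ≤ (m + 3) / 2 * (s₀.frac * (1 - s₀.frac) / s₀.total) :=
  le_of_tendsto' (h.tendsto_integral_frac hL (g := fun x => (x - s₀.frac) ^ 2) (by fun_prop))
    fun n => h.integral_sq_le hm hs n

lemma le_integral_limit_sq :
    s₀.frac * (1 - s₀.frac) / s₀.total / 4 ≤ ∫ ω, (L ω - s₀.frac) ^ 2 ∂P := by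
  refine le_of_tendsto_of_tendsto' ?_ (h.tendsto_integral_frac hL
    (g := fun x => (x - s₀.frac) ^ 2) (by fun_prop)) fun n => h.le_integral_sq hm hs n
  have := (((tendsto_one_div_add_mul_natCast hm s₀.total).const_sub (1 / s₀.total)).div_const 4).const_mul (s₀.frac * (1 - s₀.frac))
  convert this using 2
  ring

lemma integral_limit_fourth_le :
    ∫ ω, (L ω - s₀.frac) ^ 4 ∂P ≤
      fourthMomentConst m * (s₀.frac * (1 - s₀.frac) / s₀.total) ^ 2 := by
  refine le_of_tendsto_of_tendsto' (h.tendsto_integral_frac hL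
    (g := fun x => (x - s₀.frac) ^ 4) (by fun_prop)) ?_ fun n => h.integral_fourth_le_sub hm hs n
  have := ((tendsto_one_div_add_mul_natCast hm s₀.total).const_sub (1 / s₀.total)).const_mul
    (fourthMomentConst m * (s₀.frac * (1 - s₀.frac)) ^ 2 / s₀.total)
  convert this using 2
  ring

/-- A uniform bound for the probability that the limit has a given value. -/
lemma measureReal_limit_eq_le (r : ℝ) :
    P.real {ω | L ω = r} ≤ 1 - 1 / (8 * (16 * fourthMomentConst m + 1)) := by
  have hK := fourthMomentConst_nonneg m
  have hV := h.le_integral_limit_sq hL hm hs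
  have h4 := h.integral_limit_fourth_le hL hm hs
  have ha : 0 < s₀.frac * (1 - s₀.frac) / s₀.total :=
    div_pos hs.frac_mul_one_sub_pos hs.total_pos
  have i1 := h.integrable_limit hL (g := fun x => x - s₀.frac) (by fun_prop)
  have i2 := h.integrable_limit hL (g := fun x => (x - s₀.frac) ^ 2) (by fun_prop)
  have i4 := h.integrable_limit hL (g := fun x => (x - s₀.frac) ^ 4) (by fun_prop)
  have j4 := h.integrable_limit hL (g := fun x => (x - r) ^ 4) (by fun_prop)
  have j2 := h.integrable_limit hL (g := fun x => (x - r) ^ 2) (by fun_prop)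
  have hmean : ∫ ω, (L ω - s₀.frac) ∂P = 0 := by
    rw [integral_sub (h.integrable_limit hL (g := fun x => x) continuous_id) (integrable_const _),
      h.integral_limit hL hm hs]
    simp
  set K := fourthMomentConst m
  set a := s₀.frac * (1 - s₀.frac) / s₀.total
  set V := ∫ ω, (L ω - s₀.frac) ^ 2 ∂P
  set s := s₀.frac - r with hsdef
  have hM2 : ∫ ω, (L ω - r) ^ 2 ∂P = V + s ^ 2 := by
    have e : ∀ ω, (L ω - r) ^ 2 = (L ω - s₀.frac) ^ 2 + (2 * s * (L ω - s₀.frac) + s ^ 2) :=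
      fun ω => by simp only [s]; ring
    simp only [e]
    rw [integral_add i2 (h.integrable_limit hL (g := fun x => 2 * s * (x - s₀.frac) + s ^ 2)
        (by fun_prop)),
      integral_add (i1.const_mul _) (integrable_const _), integral_const_mul, hmean]
    simp [V]
  -- From (w + s)⁴ ≤ 8w⁴ + 8s⁴ and a ≤ 4V; the resulting constant depends neither on `r` nor on the
  -- starting state.
  have hM4 : ∫ ω, (L ω - r) ^ 4 ∂P ≤ 8 * (16 * K + 1) * (V + s ^ 2) ^ 2 := by
    calc _ ≤ ∫ ω, (8 * (L ω - s₀.frac) ^ 4 + 8 * s ^ 4) ∂P := by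
          refine integral_mono j4 ((i4.const_mul _).add (integrable_const _)) fun ω => ?_
          have e : L ω - r = (L ω - s₀.frac) + s := by simp only [s]; ring
          simp only [e]
          set w := L ω - s₀.frac
          nlinarith [sq_nonneg (w - s), sq_nonneg (w + s), sq_nonneg (w ^ 2 - s ^ 2),
            mul_nonneg (sq_nonneg (w - s)) (sq_nonneg (w - s)),
            mul_nonneg (sq_nonneg (w - s)) (sq_nonneg (w + s))]
      _ = 8 * ∫ ω, (L ω - s₀.frac) ^ 4 ∂P + 8 * s ^ 4 := by
          rw [integral_add (i4.const_mul _) (integrable_const _), integral_const_mul]; simp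
      _ ≤ 8 * (K * (4 * V) ^ 2) + 8 * s ^ 4 := by
          gcongr
          refine h4.trans ?_
          gcongr
          linarith
      _ ≤ _ := by
          have : 0 ≤ V := by linarith
          have h1 : 0 ≤ K * (V * s ^ 2) := by positivity
          have h2 : 0 ≤ K * s ^ 4 := by positivity
          have h3 : 0 ≤ V * s ^ 2 := by positivity
          nlinarith [sq_nonneg V]
  have hMpos : 0 < V + s ^ 2 := by nlinarith [sq_nonneg s]
  set M := V + s ^ 2
  set C := 8 * (16 * K + 1) with hC
  have hCpos : 0 < C := by positivity
  have hnull : NullMeasurableSet {ω | L ω = r} P :=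
    (h.aemeasurable_limit hL).nullMeasurableSet_preimage (measurableSet_singleton r)
  set q := P.real {ω | L ω = r}ᶜ with hq
  -- Cauchy-Schwarz in additive form: with z = (L - r)², integrate z ≤ (z²/(CM) + CM)/2 over {L ≠
  -- r}; where L = r both integrands vanish.
  have hle : M ≤ (1 / (C * M) * ∫ ω, (L ω - r) ^ 4 ∂P + C * M * q) / 2 := by
    have hind : ∫ ω, ({ω | L ω = r}ᶜ).indicator (fun _ => (1 : ℝ)) ω ∂P = q := by
      rw [integral_indicator₀ hnull.compl, setIntegral_const, smul_eq_mul, mul_one]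
    have iind : Integrable (({ω | L ω = r}ᶜ).indicator (fun _ => (1 : ℝ))) P :=
      (integrable_const (1 : ℝ)).indicator₀ hnull.compl
    rw [← hind, ← integral_const_mul, ← integral_const_mul, ← integral_add (j4.const_mul _)
      (iind.const_mul _), ← integral_div]
    refine hM2.symm.le.trans ?_
    refine integral_mono j2 (((j4.const_mul _).add (iind.const_mul _)).div_const _) fun ω => ?_
    have hCM : 0 < C * M := by positivity
    by_cases hω : L ω = r
    · simp [hω]
    · have : ω ∈ ({ω | L ω = r}ᶜ : Set Ω) := hω
      simp only [Set.indicator_of_mem this]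
      have e : (1 / (C * M) * (L ω - r) ^ 4 + (C * M) * 1) / 2
          - (L ω - r) ^ 2 = ((L ω - r) ^ 2 - C * M) ^ 2 /
            (2 * (C * M)) := by
        field_simp
        ring
      have : 0 ≤ ((L ω - r) ^ 2 - C * M) ^ 2 /
            (2 * (C * M)) := by positivity
      linarith
  have h5 : 1 / (C * M) * ∫ ω, (L ω - r) ^ 4 ∂P ≤ M := by
    calc _ ≤ 1 / (C * M) * (C * M ^ 2) := by gcongr
      _ = M := by field_simp
  have h6 : 1 / C ≤ q := by
    rw [div_le_iff₀ hCpos]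
    have : M * 1 ≤ M * (q * C) := by nlinarith
    exact le_of_mul_le_mul_left this hMpos
  have h7 : q = 1 - P.real {ω | L ω = r} := by
    rw [hq, probReal_compl_eq_one_sub₀ hnull]
  linarith

end

/-- The limit is not equal to a given number, almost surely. -/
lemma measure_limit_eq_zero (h : IsMarkovChain (UrnState.trans m) s₀ P U) {L : Ω → ℝ}
    (hL : ∀ᵐ ω ∂P, Tendsto (fun n => (U n ω).frac) atTop (𝓝 (L ω)))
    (hLm : StronglyMeasurable[⨆ n, historyFiltration h.measurable n] L)
    (hm : m ≠ 0) (hs : s₀.IsMixed) (r : ℝ) : P {ω | L ω = r} = 0 := by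
  set δ := 1 / (8 * (16 * fourthMomentConst m + 1)) with hδ
  have hδ0 : 0 < δ := by have := fourthMomentConst_nonneg m; positivity
  set E := {ω | L ω = r} with hE
  have hle : ⨆ n, historyFiltration h.measurable n ≤ mΩ :=
    iSup_le fun n => (historyFiltration h.measurable).le n
  have hEm' : MeasurableSet[⨆ n, historyFiltration h.measurable n] E :=
    hLm.measurable (measurableSet_singleton r)
  have hEm : MeasurableSet E := hle _ hEm'
  -- Conditioned on a history of positive probability, the future is an urn from a mixed state with
  -- the same limit, so the uniform bound applies.
  have hatom : ∀ n (b : Finset.Iic n → UrnState),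
      P.real (history U n ⁻¹' {b} ∩ E) ≤ (1 - δ) * P.real (history U n ⁻¹' {b}) := by
    intro n b
    by_cases h0 : P (history U n ⁻¹' {b}) = 0
    · have h1 : P (history U n ⁻¹' {b} ∩ E) = 0 := measure_mono_null Set.inter_subset_left h0
      simp [measureReal_def, h0, h1]
    let g : ℕ → UrnState := fun i => if hi : i ≤ n then b ⟨i, Finset.mem_Iic.2 hi⟩ else s₀
    have hA : history U n ⁻¹' {b} = {ω | ∀ i ≤ n, U i ω = g i} := by
      ext ω
      simp only [Set.mem_preimage, Set.mem_singleton_iff, Set.mem_ofPred_eq, funext_iff, history]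
      constructor
      · intro hω i hi
        simp only [g, hi, dite_true]
        exact hω ⟨i, _⟩
      · rintro hω ⟨i, hi⟩
        have hi' := Finset.mem_Iic.1 hi
        have := hω i hi'
        simpa only [g, hi', dite_true] using this
    have hAm := h.measurableSet_path n g
    rw [hA] at h0 ⊢
    have := cond_isProbabilityMeasure h0
    have hc := h.cond_path n g
    have hac : P[|{ω | ∀ i ≤ n, U i ω = g i}] ≪ P := cond_absolutelyContinuous
    have hmix : (g n).IsMixed := by
      have h1 : ∀ᵐ ω ∂P[|{ω | ∀ i ≤ n, U i ω = g i}], (U n ω).IsMixed := by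
        filter_upwards [hac.ae_le (h.ae_urn hs)] with ω hω using (hω n).1
      obtain ⟨ω, h2, h3⟩ := (h1.and hc.init).exists
      simp only [add_zero] at h3
      rwa [h3] at h2
    have hlim : ∀ᵐ ω ∂P[|{ω | ∀ i ≤ n, U i ω = g i}],
        Tendsto (fun k => (U (n + k) ω).frac) atTop (𝓝 (L ω)) := by
      filter_upwards [hac.ae_le hL] with ω hω
      simpa only [add_comm] using (tendsto_add_atTop_iff_nat n).2 hω
    have hb := hc.measureReal_limit_eq_le hlim hm hmix r
    rw [measureReal_def, cond_apply hAm, ENNReal.toReal_mul, ENNReal.toReal_inv] at hb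
    have hpos : 0 < (P {ω | ∀ i ≤ n, U i ω = g i}).toReal :=
      ENNReal.toReal_pos h0 (measure_ne_top _ _)
    rw [inv_mul_le_iff₀ hpos, mul_comm] at hb
    exact hb
  -- A conditional expectation given the history is constant on each set of fixed history, and
  -- almost surely that set has positive probability; so `hatom` bounds it pointwise.
  have hcond : ∀ n, ∀ᵐ ω ∂P,
      (P[E.indicator (fun _ => (1 : ℝ)) | historyFiltration h.measurable n]) ω ≤ 1 - δ := by
    intro n
    have hm' := measurable_history h.measurable n
    set Y := P[E.indicator (fun _ => (1 : ℝ)) | historyFiltration h.measurable n] with hY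
    have iE : Integrable (E.indicator (fun _ => (1 : ℝ))) P := (integrable_const 1).indicator hEm
    have hYm : Measurable[MeasurableSpace.comap (history U n) inferInstance] Y :=
      (stronglyMeasurable_condExp (m := historyFiltration h.measurable n)).measurable
    obtain ⟨f, hf, hfY⟩ := hYm.exists_eq_measurable_comp
    have hae : ∀ᵐ ω ∂P, ∀ b, P (history U n ⁻¹' {b}) = 0 → history U n ω ≠ b := by
      rw [ae_all_iff]
      intro b
      by_cases h0 : P (history U n ⁻¹' {b}) = 0
      · filter_upwards [measure_eq_zero_iff_ae_notMem.1 h0] with ω hω _ hc using hω hc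
      · exact ae_of_all _ fun ω h1 => absurd h1 h0
    filter_upwards [hae] with ω hω
    have h0 : P (history U n ⁻¹' {history U n ω}) ≠ 0 := fun hc => hω _ hc rfl
    have hpos : 0 < P.real (history U n ⁻¹' {history U n ω}) :=
      ENNReal.toReal_pos h0 (measure_ne_top _ _)
    have h1 := setIntegral_condExp ((historyFiltration h.measurable).le n) iE
      (s := history U n ⁻¹' {history U n ω}) ⟨_, measurableSet_singleton _, rfl⟩
    have h2 : ∫ ω' in history U n ⁻¹' {history U n ω}, Y ω' ∂P =
        P.real (history U n ⁻¹' {history U n ω}) * Y ω := by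
      rw [setIntegral_congr_fun (g := fun _ => Y ω) (hm' (measurableSet_singleton _))]
      · rw [setIntegral_const, smul_eq_mul]
      · intro ω' hω'
        have : history U n ω' = history U n ω := hω'
        simp only [hfY, Function.comp_apply, this]
    rw [h2, setIntegral_indicator hEm, setIntegral_const, smul_eq_mul, mul_one] at h1
    have h3 := hatom n (history U n ω)
    rw [← h1, mul_comm (1 - δ)] at h3
    exact le_of_mul_le_mul_left h3 hpos
  -- The conditional probabilities tend to the indicator of `E`, which is thus at most 1 - δ < 1
  -- almost surely.
  have hlevy := ((integrable_const (1 : ℝ)).indicator hEm (μ := P)).tendsto_ae_condExp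
    (ℱ := historyFiltration h.measurable) (stronglyMeasurable_const.indicator hEm')
  rw [measure_eq_zero_iff_ae_notMem]
  filter_upwards [hlevy, ae_all_iff.2 hcond] with ω h1 h2 hω
  have h3 := le_of_tendsto' h1 h2
  rw [Set.indicator_of_mem hω] at h3
  linarith

end IsMarkovChain

end UrnLimit

/-! ### Support of the limit law and its dependence on the initial degrees. -/

section UrnLimitLaw

open ProbabilityTheory

namespace UrnState

variable {m : ℕ} {s : UrnState}

lemma IsMixed.frac_pos (h : s.IsMixed) : 0 < s.frac :=
  div_pos (by exact_mod_cast h.1) h.total_pos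

lemma IsMixed.frac_lt_one (h : s.IsMixed) : s.frac < 1 := by
  have := h.frac_mul_one_sub_pos
  nlinarith [h.frac_pos]

/-- The term k = m with a red new node alone contributes x^m; other terms can only add to it. -/
lemma IsMixed.trans_all_red_pos (h : s.IsMixed) (hm : m ≠ 0) :
    0 < s.trans m (s.add m m true) := by
  classical
  have hm' : (m : ℝ) ≠ 0 := by exact_mod_cast hm
  have h0 := h.frac_pos
  have h1 := h.frac_lt_one
  have e : s.trans m (s.add m m true) = Finsupp.linearCombination ℝ
      (fun t => if t = s.add m m true then (1 : ℝ) else 0) (s.trans m) := by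
    rw [Finsupp.linearCombination_apply, Finsupp.sum]
    simp +contextual
  rw [e, linearCombination_trans]
  calc 0 < s.frac ^ m := by positivity
    _ = urnMean m s.frac fun k c => if k = m ∧ c = true then 1 else 0 := by
        rw [urnMean, Finset.sum_eq_single m]
        · simp [div_self hm']
        · intro k _ hk
          simp [hk]
        · simp
    _ ≤ _ := by
        refine urnMean_mono h0.le h1.le fun k _ c => ?_
        by_cases hc : k = m ∧ c = true
        · rw [hc.1, hc.2]; simp
        · rw [if_neg hc]; positivity

lemma IsMixed.trans_all_blue_pos (h : s.IsMixed) (m : ℕ) :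
    0 < s.trans m (s.add m 0 false) := by
  classical
  have h0 := h.frac_pos
  have h1 := h.frac_lt_one
  have e : s.trans m (s.add m 0 false) = Finsupp.linearCombination ℝ
      (fun t => if t = s.add m 0 false then (1 : ℝ) else 0) (s.trans m) := by
    rw [Finsupp.linearCombination_apply, Finsupp.sum]
    simp +contextual
  rw [e, linearCombination_trans]
  have h2 : 0 < 1 - s.frac := by linarith
  calc 0 < (1 - s.frac) ^ m := by positivity
    _ = urnMean m s.frac fun k c => if k = 0 ∧ c = false then 1 else 0 := by
        rw [urnMean, Finset.sum_eq_single 0]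
        · simp
        · intro k _ hk
          simp [hk]
        · simp
    _ ≤ _ := by
        refine urnMean_mono h0.le h1.le fun k _ c => ?_
        by_cases hc : k = 0 ∧ c = false
        · rw [hc.1, hc.2]; simp
        · rw [if_neg hc]; positivity

/-- The path on which the first `a` new nodes and all their neighbours are red, and all later ones
are blue. -/
def steeredPath (m : ℕ) (s₀ : UrnState) (a : ℕ) : ℕ → UrnState
  | 0 => s₀
  | n + 1 => if n < a then (steeredPath m s₀ a n).add m m true
      else (steeredPath m s₀ a n).add m 0 false

lemma steeredPath_isMixed {s₀ : UrnState} (hs : s₀.IsMixed) (m a n : ℕ) :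
    (steeredPath m s₀ a n).IsMixed := by
  induction n with
  | zero => exact hs
  | succ n ih => rw [steeredPath]; split_ifs <;> exact ih.add _ _ _

lemma steeredPath_total (m : ℕ) (s₀ : UrnState) (a n : ℕ) :
    (steeredPath m s₀ a n).total = s₀.total + 2 * m * n := by
  induction n with
  | zero => simp [steeredPath]
  | succ n ih =>
    rw [steeredPath]
    split_ifs
    · rw [total_add le_rfl, ih]; push_cast; ring
    · rw [total_add (Nat.zero_le _), ih]; push_cast; ring

lemma steeredPath_redDeg (m : ℕ) (s₀ : UrnState) (a n : ℕ) :
    (steeredPath m s₀ a n).redDeg = s₀.redDeg + 2 * m * min n a := by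
  induction n with
  | zero => simp [steeredPath]
  | succ n ih =>
    rw [steeredPath]
    split_ifs with hn
    · have h1 : min (n + 1) a = min n a + 1 := by lia
      simp only [UrnState.add, redGain, ih, h1, if_true]
      ring
    · have h1 : min (n + 1) a = min n a := by lia
      simp [UrnState.add, redGain, ih, h1]

/-- The initial degrees shift the numerator by at most `s₀.total`, and rounding `t * n` by at most
2m. -/
lemma abs_frac_steeredPath_sub_le {s₀ : UrnState} (hs : s₀.IsMixed) (m n : ℕ) {t : ℝ}
    (ht0 : 0 ≤ t) (ht1 : t ≤ 1) :
    |(steeredPath m s₀ ⌊t * n⌋₊ n).frac - t| ≤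
      (s₀.total + 2 * m) * (1 / (s₀.total + 2 * m * n)) := by
  have hD := hs.total_pos
  have hDn : 0 < s₀.total + 2 * m * n := by positivity
  have htn : 0 ≤ t * n := by positivity
  have hmin : min n ⌊t * n⌋₊ = ⌊t * n⌋₊ := by
    refine min_eq_right ?_
    have : t * n ≤ n := by nlinarith [Nat.cast_nonneg (α := ℝ) n]
    exact_mod_cast (Nat.floor_le htn).trans this
  have h1 := Nat.floor_le htn
  have h2 := (Nat.lt_floor_add_one (t * n)).le
  rw [frac, steeredPath_total, steeredPath_redDeg, hmin]
  push_cast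
  set f : ℝ := (⌊t * n⌋₊ : ℝ)
  have e : (s₀.redDeg + 2 * m * f) / (s₀.total + 2 * m * n) - t =
      ((s₀.redDeg - t * s₀.total) + 2 * m * (f - t * n)) * (1 / (s₀.total + 2 * m * n)) := by
    field_simp
    ring
  rw [e, abs_mul, abs_of_pos (by positivity : 0 < 1 / (s₀.total + 2 * m * n))]
  gcongr
  have hX0 : (0 : ℝ) ≤ s₀.redDeg := by positivity
  have hX1 : (s₀.redDeg : ℝ) ≤ s₀.total := by simp [total]
  have hm0 : (0 : ℝ) ≤ m := by positivity
  rw [abs_le]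
  constructor <;> nlinarith

end UrnState

variable {Ω : Type*} [mΩ : MeasurableSpace Ω] {P : Measure Ω} [IsProbabilityMeasure P]
  {m : ℕ} {s₀ : UrnState} {U : ℕ → Ω → UrnState}

namespace IsMarkovChain

lemma measureReal_steeredPath_pos (h : IsMarkovChain (UrnState.trans m) s₀ P U) (hm : m ≠ 0)
    (hs : s₀.IsMixed) (a n : ℕ) :
    0 < P.real {ω | ∀ i ≤ n, U i ω = UrnState.steeredPath m s₀ a i} := by
  induction n with
  | zero =>
    have : {ω | ∀ i ≤ 0, U i ω = UrnState.steeredPath m s₀ a i} =ᵐ[P] Set.univ := by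
      rw [eventuallyEq_univ]
      filter_upwards [h.init] with ω hω i hi
      rw [Nat.le_zero.1 hi, hω]
      rfl
    rw [measureReal_congr this]
    simp
  | succ n ih =>
    rw [h.step]
    refine mul_pos ih ?_
    rw [UrnState.steeredPath]
    split_ifs
    · exact (UrnState.steeredPath_isMixed hs m a n).trans_all_red_pos hm
    · exact (UrnState.steeredPath_isMixed hs m a n).trans_all_blue_pos m

section

variable (h : IsMarkovChain (UrnState.trans m) s₀ P U) {L : Ω → ℝ}
  (hL : ∀ᵐ ω ∂P, Tendsto (fun n => (U n ω).frac) atTop (𝓝 (L ω))) (hm : m ≠ 0)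
  (hs : s₀.IsMixed)

include h hL hm hs

/-- Chebyshev: if L stayed at distance at least ε from the initial share, its variance would be at
least ε². The hypothesis `hεD` holds once the total degree is large. -/
lemma measure_limit_near_init_ne_zero {ε : ℝ} (hε : 0 < ε)
    (hεD : (m + 3) / 2 * (1 / s₀.total) < ε ^ 2) : P {ω | |L ω - s₀.frac| < ε} ≠ 0 := by
  intro h0
  have h1 : ∀ᵐ ω ∂P, ε ^ 2 ≤ (L ω - s₀.frac) ^ 2 := by
    filter_upwards [measure_eq_zero_iff_ae_notMem.1 h0] with ω hω
    have : ε ≤ |L ω - s₀.frac| := not_lt.1 hω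
    rw [← sq_abs (L ω - s₀.frac)]
    gcongr
  have h2 := integral_mono_ae (integrable_const _)
    (h.integrable_limit hL (g := fun x => (x - s₀.frac) ^ 2) (by fun_prop)) h1
  simp only [integral_const, probReal_univ, smul_eq_mul, one_mul] at h2
  have h3 := h.integral_limit_sq_le hL hm hs
  have hD := hs.total_pos
  have h4 : s₀.frac * (1 - s₀.frac) / s₀.total ≤ 1 / s₀.total := by
    gcongr
    nlinarith [hs.frac_pos, hs.frac_lt_one]
  have h5 : (m + 3 : ℝ) / 2 * (s₀.frac * (1 - s₀.frac) / s₀.total) ≤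
      (m + 3) / 2 * (1 / s₀.total) := by gcongr
  linarith

lemma measure_limit_near_ne_zero {t : ℝ} (ht : t ∈ Set.Icc (0 : ℝ) 1) {ε : ℝ} (hε : 0 < ε) :
    P {ω | |L ω - t| < ε} ≠ 0 := by
  have htend := tendsto_one_div_add_mul_natCast hm s₀.total
  -- For large `n` the steered share is within ε/2 of `t`, and the variance still to come is below
  -- (ε/2)².
  have e1 := (htend.const_mul (s₀.total + 2 * m)).eventually_lt_const
    (by rw [mul_zero]; exact half_pos hε : (s₀.total + 2 * m) * 0 < ε / 2)
  have e2 := (htend.const_mul ((m + 3 : ℝ) / 2)).eventually_lt_const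
    (by rw [mul_zero]; positivity : (m + 3 : ℝ) / 2 * 0 < (ε / 2) ^ 2)
  obtain ⟨n, h1, h2⟩ := (e1.and e2).exists
  set g := UrnState.steeredPath m s₀ ⌊t * n⌋₊ with hg
  have hpos := h.measureReal_steeredPath_pos hm hs ⌊t * n⌋₊ n
  have h0 : P {ω | ∀ i ≤ n, U i ω = g i} ≠ 0 := fun hc => by
    rw [measureReal_def, hc] at hpos; simp at hpos
  have := cond_isProbabilityMeasure h0
  have hc := h.cond_path n g
  have hac : P[|{ω | ∀ i ≤ n, U i ω = g i}] ≪ P := cond_absolutelyContinuous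
  have hlim : ∀ᵐ ω ∂P[|{ω | ∀ i ≤ n, U i ω = g i}],
      Tendsto (fun k => (U (n + k) ω).frac) atTop (𝓝 (L ω)) := by
    filter_upwards [hac.ae_le hL] with ω hω
    simpa only [add_comm] using (tendsto_add_atTop_iff_nat n).2 hω
  have hne := hc.measure_limit_near_init_ne_zero hlim hm
    (UrnState.steeredPath_isMixed hs m _ n) (half_pos hε)
    (by rw [UrnState.steeredPath_total]; exact h2)
  have hclose := UrnState.abs_frac_steeredPath_sub_le hs m n ht.1 ht.2
  intro hz
  refine hne (measure_mono_null (fun ω hω => ?_) (hac hz))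
  have hω' : |L ω - (g n).frac| < ε / 2 := hω
  calc |L ω - t| ≤ |L ω - (g n).frac| + |(g n).frac - t| := abs_sub_le _ _ _
    _ < ε := by rw [hg] at hω' ⊢; linarith

/-- The law of the limit has support `[0, 1]`. -/
lemma support_map_limit : (P.map L).support = Set.Icc (0 : ℝ) 1 := by
  have hLm := h.aemeasurable_limit hL
  ext t
  rw [Measure.mem_support_iff_forall]
  constructor
  · intro ht
    by_contra hc
    refine (ht _ (isClosed_Icc.isOpen_compl.mem_nhds hc)).ne' ?_
    rw [Measure.map_apply_of_aemeasurable hLm measurableSet_Icc.compl]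
    exact measure_eq_zero_iff_ae_notMem.2 (by
      filter_upwards [h.ae_limit_mem_Icc hL] with ω hω hc using hc hω)
  · intro ht V hV
    obtain ⟨ε, hε, hεV⟩ := Metric.mem_nhds_iff.1 hV
    refine lt_of_lt_of_le ?_ (measure_mono hεV)
    rw [Measure.map_apply_of_aemeasurable hLm measurableSet_ball]
    exact pos_iff_ne_zero.2 (h.measure_limit_near_ne_zero hL hm hs ht hε)

end

section Uniqueness

variable {Ω' : Type*} [mΩ' : MeasurableSpace Ω'] {P' : Measure Ω'} [IsProbabilityMeasure P']
  {s₀' : UrnState} {U' : ℕ → Ω' → UrnState}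

/-- Transitions of the degrees do not involve the numbers of nodes. Averaging one step turns `f`
into another function of the two degrees, so the induction runs over all `f`. -/
lemma integral_deg_eq (h : IsMarkovChain (UrnState.trans m) s₀ P U)
    (h' : IsMarkovChain (UrnState.trans m) s₀' P' U') (hr : s₀.redDeg = s₀'.redDeg)
    (hb : s₀.blueDeg = s₀'.blueDeg) (n : ℕ) (f : ℕ → ℕ → ℝ) :
    ∫ ω, f (U n ω).redDeg (U n ω).blueDeg ∂P = ∫ ω, f (U' n ω).redDeg (U' n ω).blueDeg ∂P' := by
  induction n generalizing f with
  | zero =>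
    rw [h.integral_init fun s => f s.redDeg s.blueDeg,
      h'.integral_init fun s => f s.redDeg s.blueDeg, hr, hb]
  | succ n ih =>
    rw [h.integral_succ n fun s => f s.redDeg s.blueDeg,
      h'.integral_succ n fun s => f s.redDeg s.blueDeg]
    simp only [UrnState.linearCombination_trans]
    exact ih fun x y => urnMean m ((x : ℝ) / (x + y)) fun k c =>
      f (x + redGain m k c) (y + redGain m (m - k) !c)

/-- The law of the limit depends on the initial total degrees of the two colours only. -/
lemma map_limit_eq (h : IsMarkovChain (UrnState.trans m) s₀ P U)
    (h' : IsMarkovChain (UrnState.trans m) s₀' P' U') (hr : s₀.redDeg = s₀'.redDeg)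
    (hb : s₀.blueDeg = s₀'.blueDeg) {L : Ω → ℝ} {L' : Ω' → ℝ}
    (hL : ∀ᵐ ω ∂P, Tendsto (fun n => (U n ω).frac) atTop (𝓝 (L ω)))
    (hL' : ∀ᵐ ω ∂P', Tendsto (fun n => (U' n ω).frac) atTop (𝓝 (L' ω))) :
    P.map L = P'.map L' := by
  have hLm := h.aemeasurable_limit hL
  have hLm' := h'.aemeasurable_limit hL'
  have := Measure.isProbabilityMeasure_map (μ := P) hLm
  have := Measure.isProbabilityMeasure_map (μ := P') hLm'
  refine ext_of_forall_integral_eq_of_IsFiniteMeasure fun g => ?_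
  rw [integral_map hLm g.continuous.aestronglyMeasurable,
    integral_map hLm' g.continuous.aestronglyMeasurable]
  refine tendsto_nhds_unique (h.tendsto_integral_frac hL g.continuous) ?_
  refine (h'.tendsto_integral_frac hL' g.continuous).congr fun n => ?_
  exact (h.integral_deg_eq h' hr hb n fun x y => g ((x : ℝ) / (x + y))).symm

end Uniqueness

end IsMarkovChain

end UrnLimitLaw

/-! ### The fraction of red nodes follows the red share of the degrees. -/

section RedNodes

namespace UrnState

/-- Excess of the total degree of the red nodes over `2 m` times their number. -/
noncomputable def excess (m : ℕ) (s : UrnState) : ℝ := s.redDeg - 2 * m * s.red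

variable {m : ℕ} {s : UrnState}

lemma excess_add (m k : ℕ) (s : UrnState) (c : Bool) :
    (s.add m k c).excess m = s.excess m + (k - m * if c then 1 else 0) := by
  cases c <;> simp [excess, UrnState.add, redGain] <;> ring

/-- The increment k - m·1{red} has mean zero given k and absolute value at most m. -/
lemma mean_excess_sq_le (hm : m ≠ 0) (s : UrnState) :
    Finsupp.linearCombination ℝ (fun t => t.excess m ^ 2) (s.trans m) ≤ s.excess m ^ 2 + m ^ 2 := by
  rw [linearCombination_trans]
  calc _ ≤ urnMean m s.frac fun k c => (s.excess m ^ 2 + m ^ 2) +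
        (2 * s.excess m) * ((k : ℝ) - m * if c then 1 else 0) := by
        refine urnMean_mono s.frac_nonneg s.frac_le_one fun k hk c => ?_
        rw [excess_add]
        have hk' : (k : ℝ) ≤ m := by exact_mod_cast hk
        have hk0 : (0 : ℝ) ≤ k := by positivity
        have : ((k : ℝ) - m * if c then 1 else 0) ^ 2 ≤ m ^ 2 := by
          cases c <;> simp <;> nlinarith
        nlinarith
    _ = _ := by rw [urnMean_add, urnMean_const, urnMean_const_mul, urnMean_sub_eq_zero hm]; ring

/-- A nonnegative supermartingale dominating the squared excess per node. -/
noncomputable def excessPotential (m : ℕ) (s : UrnState) : ℝ :=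
  (s.excess m / s.nodes) ^ 2 + m ^ 2 / s.nodes

/-- The new variance m²/(N + 1)² is paid for by the drop of m²/N to m²/(N + 1). -/
lemma mean_excessPotential_le (hm : m ≠ 0) (hs : 0 < s.nodes) :
    Finsupp.linearCombination ℝ (excessPotential m) (s.trans m) ≤ s.excessPotential m := by
  have h1 := mean_excess_sq_le hm s
  rw [linearCombination_trans] at h1 ⊢
  have e : ∀ k ≤ m, ∀ c, (s.add m k c).excessPotential m =
      (1 / (s.nodes + 1)) ^ 2 * (s.add m k c).excess m ^ 2 + m ^ 2 / (s.nodes + 1) :=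
    fun k _ c => by rw [excessPotential, nodes_add, div_pow, one_div_pow]; ring
  rw [urnMean_congr _ e, urnMean_add, urnMean_const, urnMean_const_mul]
  calc _ ≤ (1 / (s.nodes + 1)) ^ 2 * (s.excess m ^ 2 + m ^ 2) + m ^ 2 / (s.nodes + 1) := by gcongr
    _ = (s.excess m) ^ 2 / (s.nodes + 1) ^ 2 + m ^ 2 * (1 / (s.nodes + 1) ^ 2) +
        m ^ 2 / (s.nodes + 1) := by rw [one_div_pow]; ring
    _ ≤ (s.excess m) ^ 2 / s.nodes ^ 2 + m ^ 2 * ((1 / s.nodes - 1 / (s.nodes + 1)) / 1) +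
        m ^ 2 / (s.nodes + 1) := by
        have := one_div_sq_le_sub hs one_pos
        gcongr
        linarith
    _ = _ := by rw [excessPotential, div_pow]; ring

lemma excessPotential_nonneg (m : ℕ) (s : UrnState) : 0 ≤ s.excessPotential m := by
  have : 0 ≤ s.nodes := by unfold nodes; positivity
  unfold excessPotential; positivity

end UrnState

variable {Ω : Type*} [mΩ : MeasurableSpace Ω] {P : Measure Ω} [IsProbabilityMeasure P]
  {m : ℕ} {s₀ : UrnState} {U : ℕ → Ω → UrnState}

namespace IsMarkovChain

variable (h : IsMarkovChain (UrnState.trans m) s₀ P U) (hm : m ≠ 0) (hs : s₀.IsMixed)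

include h hm

lemma integral_excess_sq_le (n : ℕ) :
    ∫ ω, (U n ω).excess m ^ 2 ∂P ≤ s₀.excess m ^ 2 + m ^ 2 * n := by
  induction n with
  | zero => rw [h.integral_init fun s => s.excess m ^ 2]; simp
  | succ n ih =>
    rw [h.integral_succ n fun s => s.excess m ^ 2]
    calc _ ≤ ∫ ω, ((U n ω).excess m ^ 2 + m ^ 2) ∂P :=
          integral_mono (h.integrable n fun s => Finsupp.linearCombination ℝ
            (fun t : UrnState => t.excess m ^ 2) (s.trans m))
            (h.integrable n fun s => s.excess m ^ 2 + m ^ 2)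
            fun ω => UrnState.mean_excess_sq_le hm (U n ω)
      _ = ∫ ω, (U n ω).excess m ^ 2 ∂P + m ^ 2 := by
          rw [integral_add (h.integrable n fun s => s.excess m ^ 2) (integrable_const _)]; simp
      _ ≤ _ := by push_cast; linarith

include hs

lemma integral_excessPotential_le (h0 : 1 ≤ s₀.nodes) (n : ℕ) :
    ∫ ω, (U n ω).excessPotential m ∂P ≤
      (s₀.excess m ^ 2 + 2 * m ^ 2) * (1 / (s₀.nodes + n)) := by
  have hN : 0 < s₀.nodes + n := by positivity
  have e : ∫ ω, (U n ω).excessPotential m ∂P =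
      (1 / (s₀.nodes + n)) ^ 2 * ∫ ω, (U n ω).excess m ^ 2 ∂P + m ^ 2 / (s₀.nodes + n) := by
    have : (fun ω => (U n ω).excessPotential m) =ᵐ[P] fun ω =>
        (1 / (s₀.nodes + n)) ^ 2 * (U n ω).excess m ^ 2 + m ^ 2 / (s₀.nodes + n) := by
      filter_upwards [h.ae_urn hs] with ω hω
      rw [UrnState.excessPotential, (hω n).2.2, div_pow, one_div_pow]
      ring
    rw [integral_congr_ae this, integral_add (h.integrable n fun s =>
      (1 / (s₀.nodes + n)) ^ 2 * s.excess m ^ 2) (integrable_const _), integral_const_mul]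
    simp
  rw [e]
  calc _ ≤ (1 / (s₀.nodes + n)) ^ 2 * ((s₀.excess m ^ 2 + m ^ 2) * (s₀.nodes + n)) +
        m ^ 2 / (s₀.nodes + n) := by
        gcongr
        refine (h.integral_excess_sq_le hm n).trans ?_
        have h1 : 0 ≤ s₀.excess m ^ 2 := sq_nonneg _
        have h2 : (0 : ℝ) ≤ m ^ 2 := sq_nonneg _
        have h3 : (0 : ℝ) ≤ n := by positivity
        nlinarith [mul_nonneg h1 h3]
    _ = _ := by field_simp; ring

/-- A nonnegative supermartingale converges almost surely; its means are O(1/n), so Fatou forces the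
limit to be 0. -/
lemma tendsto_excessPotential (h0 : 1 ≤ s₀.nodes) :
    ∀ᵐ ω ∂P, Tendsto (fun n => (U n ω).excessPotential m) atTop (𝓝 0) := by
  have hsup : Supermartingale (fun n ω => (U n ω).excessPotential m)
      (historyFiltration h.measurable) P :=
    h.supermartingale (UrnState.excessPotential m) fun n => by
      filter_upwards [h.ae_urn hs] with ω hω
      refine UrnState.mean_excessPotential_le hm ?_
      rw [(hω n).2.2]
      positivity
  have hint := fun n => h.integrable n (UrnState.excessPotential m)
  have hlint : ∀ n, ∫⁻ ω, ENNReal.ofReal ((U n ω).excessPotential m) ∂P =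
      ENNReal.ofReal (∫ ω, (U n ω).excessPotential m ∂P) := fun n =>
    (ofReal_integral_eq_lintegral_ofReal (hint n)
      (ae_of_all _ fun ω => UrnState.excessPotential_nonneg m _)).symm
  have hbound : ∀ n, ∫ ω, (U n ω).excessPotential m ∂P ≤ s₀.excess m ^ 2 + 2 * m ^ 2 := fun n => by
    refine (h.integral_excessPotential_le hm hs h0 n).trans (mul_le_of_le_one_right (by positivity) ?_)
    rw [div_le_one (by positivity)]
    linarith [Nat.cast_nonneg (α := ℝ) n]
  obtain ⟨L, -, hconv⟩ := exists_stronglyMeasurable_ae_tendsto hsup.neg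
    (R := Real.toNNReal (s₀.excess m ^ 2 + 2 * m ^ 2)) fun n => by
      rw [eLpNorm_one_eq_lintegral_enorm]
      have : ∀ ω, ‖(-fun n ω => (U n ω).excessPotential m) n ω‖ₑ =
          ENNReal.ofReal ((U n ω).excessPotential m) := fun ω => by
        rw [Pi.neg_apply, Pi.neg_apply, enorm_neg,
          Real.enorm_of_nonneg (UrnState.excessPotential_nonneg m _)]
      simp only [this]
      rw [hlint]
      exact ENNReal.ofReal_le_ofReal (hbound n)
  have hmeas : ∀ n, Measurable fun ω => ENNReal.ofReal ((U n ω).excessPotential m) := fun n =>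
    (measurable_of_countable fun s : UrnState => ENNReal.ofReal (s.excessPotential m)).comp
      (h.measurable n)
  have hzero : Tendsto (fun n => ∫⁻ ω, ENNReal.ofReal ((U n ω).excessPotential m) ∂P) atTop
      (𝓝 0) := by
    simp only [hlint]
    rw [← ENNReal.ofReal_zero]
    refine ENNReal.tendsto_ofReal (squeeze_zero (fun n => integral_nonneg fun ω =>
      UrnState.excessPotential_nonneg m _) (h.integral_excessPotential_le hm hs h0) ?_)
    have h1 : Tendsto (fun n : ℕ => s₀.nodes + (n : ℝ)) atTop atTop :=
      tendsto_atTop_add_const_left _ _ tendsto_natCast_atTop_atTop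
    simpa using (tendsto_inv_atTop_zero.comp h1).const_mul (s₀.excess m ^ 2 + 2 * (m : ℝ) ^ 2)
  have hml : Measurable fun ω =>
      liminf (fun n => ENNReal.ofReal ((U n ω).excessPotential m)) atTop := .liminf hmeas
  have hfatou := lintegral_liminf_le (μ := P) (u := atTop) hmeas
  rw [hzero.liminf_eq, nonpos_iff_eq_zero,
    lintegral_eq_zero_iff hml] at hfatou
  filter_upwards [hconv, hfatou] with ω h1 h2
  have h3 := h1.neg
  simp only [Pi.neg_apply, neg_neg] at h3
  set q := -L ω
  have h4 := (ENNReal.tendsto_ofReal h3).liminf_eq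
  rw [h4] at h2
  have h5 : q ≤ 0 := ENNReal.ofReal_eq_zero.1 h2
  have h6 : 0 ≤ q := ge_of_tendsto' h3 fun n => UrnState.excessPotential_nonneg m _
  rwa [le_antisymm h5 h6] at h3

/-- The fraction of red nodes has the same limit as their share in the total degree. -/
lemma tendsto_red_div_nodes (h0 : 1 ≤ s₀.nodes) {L : Ω → ℝ}
    (hL : ∀ᵐ ω ∂P, Tendsto (fun n => (U n ω).frac) atTop (𝓝 (L ω))) :
    ∀ᵐ ω ∂P, Tendsto (fun n => ((U n ω).red : ℝ) / (U n ω).nodes) atTop (𝓝 (L ω)) := by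
  have hm' : (m : ℝ) ≠ 0 := by exact_mod_cast hm
  filter_upwards [hL, h.tendsto_excessPotential hm hs h0, h.ae_urn hs] with ω h1 h2 h3
  have h4 : Tendsto (fun n => (U n ω).excess m / (U n ω).nodes) atTop (𝓝 0) := by
    refine squeeze_zero_norm (fun n => ?_) (by simpa using h2.sqrt)
    rw [Real.norm_eq_abs]
    refine Real.abs_le_sqrt ?_
    have : 0 ≤ (U n ω).nodes := by unfold UrnState.nodes; positivity
    have : 0 ≤ (m : ℝ) ^ 2 / (U n ω).nodes := by positivity
    rw [UrnState.excessPotential]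
    linarith
  have h5 : Tendsto (fun n : ℕ => (s₀.total + 2 * m * n) / (s₀.nodes + n)) atTop (𝓝 (2 * m)) := by
    have e : ∀ n : ℕ, (s₀.total + 2 * m * n) / (s₀.nodes + n) =
        2 * m + (s₀.total - 2 * m * s₀.nodes) * (s₀.nodes + n)⁻¹ := fun n => by
      have : s₀.nodes + n ≠ 0 := by positivity
      field_simp
      ring
    simp only [e]
    have h1 : Tendsto (fun n : ℕ => s₀.nodes + (n : ℝ)) atTop atTop :=
      tendsto_atTop_add_const_left _ _ tendsto_natCast_atTop_atTop
    simpa using ((tendsto_inv_atTop_zero.comp h1).const_mul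
      (s₀.total - 2 * m * s₀.nodes)).const_add (2 * (m : ℝ))
  -- Uses A/N = (x · total/N - excess/N)/(2m), where total/N tends to 2m.
  have h6 := ((h1.mul h5).sub h4).div_const (2 * (m : ℝ))
  have e : (L ω * (2 * m) - 0) / (2 * m) = L ω := by field_simp; ring
  rw [e] at h6
  refine h6.congr fun n => ?_
  obtain ⟨hmix, htot, hnod⟩ := h3 n
  have hN : (U n ω).nodes ≠ 0 := by rw [hnod]; positivity
  have hT := hmix.total_pos.ne'
  rw [← htot, ← hnod, UrnState.frac, UrnState.excess]
  field_simp
  ring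

end IsMarkovChain

end RedNodes

/-! ### From the growing graph to the urn. -/

section GraphToUrn

/-- Summation over independent choices grouped by the number of choices that satisfy `red`. -/
lemma sum_prod_smul_card_filter {V M : Type*} [Fintype V] [AddCommGroup M] [Module ℝ M] (m : ℕ)
    (a : V → ℝ) (red : V → Bool) (F : ℕ → M) :
    ∑ t : Fin m → V, (∏ i, a (t i)) • F (Finset.univ.filter fun i => red (t i) = true).card =
      ∑ k ∈ Finset.range (m + 1), (m.choose k * (∑ v with red v = true, a v) ^ k *
        (∑ v with red v = false, a v) ^ (m - k)) • F k := by
  classical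
  set x := ∑ v with red v = true, a v
  set y := ∑ v with red v = false, a v
  -- The choices whose set of red indices is exactly `A` form a product set, so their weights
  -- factor.
  have h1 : ∀ A : Finset (Fin m),
      ∑ t : Fin m → V with (Finset.univ.filter fun i => red (t i) = true) = A, ∏ i, a (t i) =
        x ^ A.card * y ^ (m - A.card) := by
    intro A
    have e : (Finset.univ.filter fun t : Fin m → V =>
        (Finset.univ.filter fun i => red (t i) = true) = A) =
        Fintype.piFinset fun i => Finset.univ.filter fun v => red v = decide (i ∈ A) := by
      ext t
      simp only [Finset.mem_filter, Finset.mem_univ, true_and, Fintype.mem_piFinset,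
        Finset.ext_iff]
      refine forall_congr' fun i => ?_
      by_cases hi : i ∈ A <;> simp [hi]
    rw [e, ← Finset.prod_univ_sum]
    have e2 : ∀ i : Fin m, ∑ v with red v = decide (i ∈ A), a v = if i ∈ A then x else y := by
      intro i
      by_cases hi : i ∈ A <;> simp [hi, x, y]
    simp only [e2]
    rw [Finset.prod_ite]
    simp [Finset.filter_not, Finset.card_sdiff]
  rw [← Finset.sum_fiberwise Finset.univ
    (fun t : Fin m → V => Finset.univ.filter fun i => red (t i) = true)]
  have h2 : ∀ A : Finset (Fin m),
      ∑ t : Fin m → V with (Finset.univ.filter fun i => red (t i) = true) = A,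
        (∏ i, a (t i)) • F (Finset.univ.filter fun i => red (t i) = true).card =
        (x ^ A.card * y ^ (m - A.card)) • F A.card := by
    intro A
    rw [← h1 A, Finset.sum_smul]
    refine Finset.sum_congr rfl fun t ht => ?_
    rw [(Finset.mem_filter.1 ht).2]
  simp only [h2]
  rw [← Finset.powerset_univ,
    Finset.sum_powerset_apply_card (fun k => (x ^ k * y ^ (m - k)) • F k)]
  rw [Finset.card_univ, Fintype.card_fin]
  refine Finset.sum_congr rfl fun k _ => ?_
  rw [← Nat.cast_smul_eq_nsmul ℝ, smul_smul]
  congr 1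
  ring

namespace ColoredMultigraph

instance : Countable ColoredMultigraph :=
  Function.Injective.countable
    (f := fun g : ColoredMultigraph =>
      (⟨g.order, g.isRed, g.edges⟩ : Σ n : ℕ, (Fin n → Bool) × Multiset (Sym2 (Fin n))))
    fun g g' h => by
      cases g
      cases g'
      simp only [Sigma.mk.injEq] at h
      obtain ⟨rfl, h⟩ := h
      simp only [heq_eq_eq, Prod.mk.injEq] at h
      rw [h.1, h.2]

instance : MeasurableSpace ColoredMultigraph := ⊤

instance : DiscreteMeasurableSpace ColoredMultigraph := ⟨fun _ => trivial⟩

/-- The state of the urn described by a graph. -/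
def urnState (g : ColoredMultigraph) : UrnState where
  redDeg := g.redDegree
  blueDeg := g.blueDegree
  red := g.numRed
  blue := g.numBlue

variable (g : ColoredMultigraph) {m : ℕ} (t : Fin m → Fin g.order) (c : Bool)

lemma count_toMultiset_map_castSucc {n : ℕ} (v : Fin n) (e : Sym2 (Fin n)) :
    (Sym2.map Fin.castSucc e).toMultiset.count v.castSucc = e.toMultiset.count v := by
  induction e using Sym2.ind with
  | _ a b => simp [Sym2.toMultiset, List.count_cons]

lemma degree_addNode (w : Fin (g.order + 1)) :
    (g.addNode t c).degree w =
      (g.edges.map fun e => (Sym2.map Fin.castSucc e).toMultiset.count w).sum +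
        ∑ i, (s(Fin.last g.order, (t i).castSucc)).toMultiset.count w := by
  change ((g.edges.map (Sym2.map Fin.castSucc) + Finset.univ.val.map fun i : Fin m =>
    s(Fin.last g.order, (t i).castSucc)).map fun e => e.toMultiset.count w).sum = _
  rw [Multiset.map_add, Multiset.sum_add, Multiset.map_map, Multiset.map_map]
  rfl

lemma degree_addNode_castSucc (v : Fin g.order) :
    (g.addNode t c).degree (Fin.castSucc v) =
      g.degree v + (Finset.univ.filter fun i => t i = v).card := by
  have h : ∀ i : Fin m, (s(Fin.last g.order, (t i).castSucc)).toMultiset.count v.castSucc =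
      if t i = v then 1 else 0 := by
    intro i
    simp [Sym2.toMultiset, List.count_cons, (Fin.castSucc_lt_last v).ne']
  rw [degree_addNode, Finset.card_filter, degree]
  congr 1
  · simp only [count_toMultiset_map_castSucc]
  · exact Finset.sum_congr rfl fun i _ => h i

lemma degree_addNode_last : (g.addNode t c).degree (Fin.last g.order) = m := by
  have h : ∀ i : Fin m, (s(Fin.last g.order, (t i).castSucc)).toMultiset.count (Fin.last g.order) =
      1 := by
    intro i
    simp [Sym2.toMultiset, (Fin.castSucc_lt_last _).ne']
  rw [degree_addNode, Finset.sum_congr rfl fun i _ => h i]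
  simp

lemma isRed_addNode_castSucc (v : Fin g.order) :
    (g.addNode t c).isRed (Fin.castSucc v) = g.isRed v :=
  Fin.snoc_castSucc (α := fun _ => Bool) c g.isRed v

lemma isRed_addNode_last : (g.addNode t c).isRed (Fin.last g.order) = c :=
  Fin.snoc_last (α := fun _ => Bool) c g.isRed

/-- Each new edge has one end at an old node, counted by the colour of its target, and one at the
new node; none is a loop. -/
lemma sum_degree_addNode (b : Bool) :
    ∑ v with (g.addNode t c).isRed v = b, (g.addNode t c).degree v =
      ∑ v with g.isRed v = b, g.degree v + (Finset.univ.filter fun i => g.isRed (t i) = b).card +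
        if c = b then m else 0 := by
  rw [Finset.sum_filter]
  refine (Fin.sum_univ_castSucc (n := g.order) fun v : Fin (g.order + 1) =>
    if (g.addNode t c).isRed v = b then (g.addNode t c).degree v else 0).trans ?_
  rw [isRed_addNode_last, degree_addNode_last]
  simp only [isRed_addNode_castSucc, degree_addNode_castSucc]
  rw [← Finset.sum_filter, Finset.sum_add_distrib]
  congr 2
  simp only [Finset.card_filter]
  rw [Finset.sum_comm]
  refine Finset.sum_congr rfl fun i _ => ?_
  simp [Finset.sum_ite_eq]

lemma card_isRed_addNode (b : Bool) :
    (Finset.univ.filter fun v => (g.addNode t c).isRed v = b).card =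
      (Finset.univ.filter fun v => g.isRed v = b).card + if c = b then 1 else 0 := by
  rw [Finset.card_filter]
  refine (Fin.sum_univ_castSucc (n := g.order) fun v : Fin (g.order + 1) =>
    if (g.addNode t c).isRed v = b then 1 else 0).trans ?_
  rw [isRed_addNode_last, Finset.card_filter]
  simp only [isRed_addNode_castSucc]

lemma numRedTargets_le : g.numRedTargets t ≤ m :=
  (Finset.card_le_univ _).trans (Fintype.card_fin m).le

lemma card_blue_targets :
    (Finset.univ.filter fun i => g.isRed (t i) = false).card = m - g.numRedTargets t := by
  have h := Finset.card_filter_add_card_filter_not (s := (Finset.univ : Finset (Fin m)))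
    (fun i => g.isRed (t i) = true)
  simp only [Bool.not_eq_true, Finset.card_univ, Fintype.card_fin] at h
  rw [numRedTargets]
  lia

lemma urnState_addNode :
    (g.addNode t c).urnState = g.urnState.add m (g.numRedTargets t) c := by
  have h1 := g.sum_degree_addNode t c true
  have h2 := g.sum_degree_addNode t c false
  have h3 := g.card_isRed_addNode t c true
  have h4 := g.card_isRed_addNode t c false
  rw [card_blue_targets] at h2
  ext
  · exact h1.trans (add_assoc _ _ _)
  · refine h2.trans ((add_assoc _ _ _).trans ?_)
    cases c <;> rfl
  · exact h3
  · refine h4.trans ?_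
    cases c <;> rfl

/-- The transition probabilities of the growing graph as finitely supported functions. -/
noncomputable def trans (m : ℕ) (p : ℕ → ℝ) (g : ColoredMultigraph) : ColoredMultigraph →₀ ℝ :=
  ∑ t : Fin m → Fin g.order, ∑ c : Bool, Finsupp.single (g.addNode t c) (choiceProb p g t c)

lemma trans_apply (m : ℕ) (p : ℕ → ℝ) (g g' : ColoredMultigraph) :
    trans m p g g' = transProb m p g g' := by
  classical
  simp only [trans, transProb, Finsupp.finsetSum_apply, Finsupp.single_apply]

lemma sum_degree : ∑ u, (g.degree u : ℝ) = g.urnState.total := by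
  have h := Finset.sum_filter_add_sum_filter_not Finset.univ (fun v => g.isRed v = true) g.degree
  simp only [Bool.not_eq_true] at h
  rw [UrnState.total, ← Nat.cast_sum, ← Nat.cast_add]
  exact congrArg _ h.symm

lemma sum_attachProb_red : ∑ v with g.isRed v = true, g.attachProb v = g.urnState.frac := by
  simp only [attachProb, sum_degree]
  rw [← Finset.sum_div, ← Nat.cast_sum]
  rfl

/-- Without edges all attachment probabilities are 0 (division by zero), and the two colours do not
sum to 1. -/
lemma sum_attachProb_blue (h : g.urnState.total ≠ 0) :
    ∑ v with g.isRed v = false, g.attachProb v = 1 - g.urnState.frac := by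
  simp only [attachProb, sum_degree]
  rw [← Finset.sum_div, ← Nat.cast_sum, UrnState.frac, eq_sub_iff_add_eq, ← add_div,
    div_eq_one_iff_eq h, add_comm]
  rfl

/-- In the linear model the colour classes of the growing graph evolve like the urn. -/
lemma mapDomain_trans {p : ℕ → ℝ} (hp : ∀ k ≤ m, p k = (k : ℝ) / m)
    (h : g.urnState.total ≠ 0) :
    (trans m p g).mapDomain urnState = g.urnState.trans m := by
  have e : ∀ t : Fin m → Fin g.order,
      Finsupp.mapDomain urnState (∑ c : Bool, Finsupp.single (g.addNode t c) (choiceProb p g t c)) =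
        (∏ i, g.attachProb (t i)) • (fun k => Finsupp.single (g.urnState.add m k true) (k / m : ℝ) +
          Finsupp.single (g.urnState.add m k false) (1 - k / m : ℝ)) (g.numRedTargets t) := by
    intro t
    simp only [Fintype.sum_bool, Finsupp.mapDomain_add, Finsupp.mapDomain_single, urnState_addNode,
      choiceProb, hp _ (g.numRedTargets_le t), if_true, smul_add, Finsupp.smul_single, smul_eq_mul,
      Bool.false_eq_true, if_false]
  rw [trans, Finsupp.mapDomain_finsetSum]
  simp only [e]
  refine (sum_prod_smul_card_filter m g.attachProb g.isRed fun k =>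
    Finsupp.single (g.urnState.add m k true) (k / m : ℝ) +
      Finsupp.single (g.urnState.add m k false) (1 - k / m : ℝ)).trans ?_
  rw [sum_attachProb_red, sum_attachProb_blue g h]
  rfl

lemma exists_addNode_of_trans_ne_zero {p : ℕ → ℝ} {g g' : ColoredMultigraph}
    (h : trans m p g g' ≠ 0) : ∃ (t : Fin m → Fin g.order) (c : Bool), g' = g.addNode t c := by
  classical
  by_contra! hc
  refine h ?_
  rw [trans_apply, transProb]
  exact Finset.sum_eq_zero fun t _ => Finset.sum_eq_zero fun c _ => if_neg (hc t c).symm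

end ColoredMultigraph

namespace IsPrefAttachProcess

variable {m : ℕ} {p : ℕ → ℝ} {g₀ : ColoredMultigraph} {Ω : Type*} [MeasurableSpace Ω]
  {P : Measure Ω} {G : ℕ → Ω → ColoredMultigraph}

lemma isMarkovChain (h : IsPrefAttachProcess m p g₀ P G) :
    IsMarkovChain (ColoredMultigraph.trans m p) g₀ P G where
  measurable n := measurable_to_countable' fun g => h.measurableSet_eq n g
  init := h.init
  step n q := by rw [ColoredMultigraph.trans_apply]; exact h.step n q

/-- In the linear model the colour classes form an urn process. -/
lemma isMarkovChain_urnState [IsProbabilityMeasure P] (h : IsPrefAttachProcess m p g₀ P G)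
    (hp : ∀ k ≤ m, p k = (k : ℝ) / m) (hg : g₀.urnState.IsMixed) :
    IsMarkovChain (UrnState.trans m) g₀.urnState P (fun n ω => (G n ω).urnState) := by
  refine h.isMarkovChain.comp ColoredMultigraph.urnState fun n => ?_
  filter_upwards [h.init, h.isMarkovChain.ae_mem_support] with ω h0 h1
  -- Mixedness persists along the process, so the total degree is nonzero wherever `mapDomain_trans`
  -- is applied.
  have hmix : ∀ n, (G n ω).urnState.IsMixed := by
    intro n
    induction n with
    | zero => rw [h0]; exact hg
    | succ n ih =>
      obtain ⟨t, c, e⟩ := ColoredMultigraph.exists_addNode_of_trans_ne_zero (h1 n)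
      rw [e, ColoredMultigraph.urnState_addNode]
      exact ih.add _ _ _
  exact (G n ω).mapDomain_trans hp (hmix n).total_pos.ne'

end IsPrefAttachProcess

lemma ColoredMultigraph.one_le_nodes_urnState {g : ColoredMultigraph} (h : 0 < g.redDegree) :
    1 ≤ g.urnState.nodes := by
  have h1 : 0 < g.numRed := by
    rw [ColoredMultigraph.numRed, Finset.card_pos]
    by_contra hc
    rw [Finset.not_nonempty_iff_eq_empty] at hc
    rw [ColoredMultigraph.redDegree, hc] at h
    simp at h
  have h2 : (1 : ℝ) ≤ g.numRed := by exact_mod_cast h1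
  have h3 : (0 : ℝ) ≤ g.numBlue := by positivity
  calc (1 : ℝ) ≤ g.numRed + g.numBlue := by linarith
    _ = _ := rfl

end GraphToUrn

theorem theorem1 (m : ℕ) (hm : 1 ≤ m) (x₀ y₀ : ℕ) (hx₀ : 0 < x₀) (hy₀ : 0 < y₀) :
    ∃ ν : Measure ℝ, IsProbabilityMeasure ν ∧ ν.support = Set.Icc (0 : ℝ) 1 ∧
      (∀ r : ℝ, ν {r} = 0) ∧
      ∀ (p : ℕ → ℝ), (∀ k ≤ m, p k = (k : ℝ) / (m : ℝ)) →
      ∀ (g₀ : ColoredMultigraph), g₀.redDegree = x₀ → g₀.blueDegree = y₀ →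
      ∀ {Ω : Type*} [MeasurableSpace Ω] (P : Measure Ω) [IsProbabilityMeasure P]
        (G : ℕ → Ω → ColoredMultigraph), IsPrefAttachProcess m p g₀ P G →
        ∃ a : Ω → ℝ, Measurable a ∧
          (∀ᵐ ω ∂P, Tendsto (fun n => (G n ω).redFraction) atTop (𝓝 (a ω))) ∧
          P.map a = ν := by
  have hm' : m ≠ 0 := by lia
  -- The law is taken from a reference urn with these degrees; its node counts 0 and 1 are
  -- immaterial. A reference graph need not exist, for instance if x₀ + y₀ is odd.
  have hs : (⟨x₀, y₀, 0, 1⟩ : UrnState).IsMixed := ⟨hx₀, hy₀⟩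
  obtain ⟨P₀, U₀, hP₀, h₀⟩ := exists_isMarkovChain (UrnState.trans m) (UrnState.trans_nonneg m)
    (UrnState.sum_trans m) ⟨x₀, y₀, 0, 1⟩
  obtain ⟨L₀, hL₀m, hL₀⟩ := h₀.exists_limit_frac hm' hs
  refine ⟨P₀.map L₀, Measure.isProbabilityMeasure_map (h₀.aemeasurable_limit hL₀),
    h₀.support_map_limit hL₀ hm' hs, fun r => ?_, ?_⟩
  · rw [Measure.map_apply_of_aemeasurable (h₀.aemeasurable_limit hL₀) (measurableSet_singleton r)]
    exact h₀.measure_limit_eq_zero hL₀ hL₀m hm' hs r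
  · rintro p hp g₀ rfl rfl Ω _ P _ G hG
    have hg : g₀.urnState.IsMixed := ⟨hx₀, hy₀⟩
    have h := hG.isMarkovChain_urnState hp hg
    obtain ⟨L, hLm, hL⟩ := h.exists_limit_frac hm' hg
    refine ⟨L, (hLm.mono (iSup_le fun n => (historyFiltration h.measurable).le n)).measurable, ?_,
      h.map_limit_eq h₀ rfl rfl hL hL₀⟩
    exact h.tendsto_red_div_nodes hm' hg (ColoredMultigraph.one_le_nodes_urnState hx₀) hL
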